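/- Let $q=64$, $\ell=8$, $n=585$. For $a\in\mathbb Z_n$ let $S_a=\{aq^i \bmod n: i\ge 0\}$ be the $q$-cyclotomic coset of $a$ modulo $n$, and let $\mathcal A$ be the set of all these cosets. For a set $\mathcal S$ of cosets put $\ell\mathcal S=\{S_{\ell a}: S_a\in\mathcal S\}$, let $\mathcal S^*$ be the set of the cosets $-S=\{-x:x\in S\}$ with $S\in\mathcal S$, and let $\mathcal T=\{\{0\}\}\cup(\mathcal A\setminus(\ell\mathcal S)^*)$. Call $\mathcal S\subseteq\mathcal A$ *admissible for $d$* if $\{0\}\in\mathcal S$, $\mathcal S\subseteq\mathcal T$, and $S_a\in(\ell\mathcal S)^*$ for all $n+2-d\le a\le n-1$. Let $U_n$ be the group of $n$-th roots of unity in $\mathbb F_{q^2}$, and let $C_{\mathcal S}$ be the $\mathbb F_q$-linear code of all words $(f(\beta))_{\beta\in U_n\cup\{0\}}$, where $f$ runs through the $\mathbb F_q$-span of the polynomials $\sum_{i=0}^{s_a-1}(\gamma x^a)^{q^i}$ with $S_a\in\mathcal S$, $s_a=|S_a|$, $\gamma\in\mathbb F_{q^{s_a}}$. An $\ell$-ary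 quantum code $[[N,k,d]]$ is a subspace of dimension $\ell^k$ of $(\mathbb C^\ell)^{\otimes N}$ with minimum distance $d$, i.e. $d$ is the largest integer such that the code detects (in the sense of the Knill–Laflamme condition $PEP=c_EP$, with $P$ the orthogonal projection onto the code) every error operator $E$ that acts on fewer than $d$ of the $N$ tensor factors. Then: 1. The order of $64$ modulo $585$ is $2$. For $\mathcal S=\{\{0\},\{8,512\},\{16,439\}\}$ one has $8\mathcal S=\{\{0\},\{1,64\},\{2,128\}\}$ and $(8\mathcal S)^*=\{\{0\},\{457,583\},\{521,584\}\}$; $\mathcal S$ is admissible for $d=4$, and $586-2\dim_{\mathbb F_{64}}C_{\mathcal S}=576$. There is an $8$-ary quantum code $[[586,576,4]]$. 2. For each of the parameters $[[586,K,d]]$ in the list $[[586,572,5]]$, $[[586,568,6]]$, $[[586,564,7]]$, $[[586,560,8]]$, $[[586,556,9]]$, $[[586,552,10]]$, $[[586,548,11]]$, $[[586,544,12]]$, $[[586,540,13]]$, $[[586,536,14]]$, $[[586,532,15]]$, there is a set $\mathcal S$ of cosets that is admissible for $d$ with $586-2\dim_{\mathbb F_{64}}C_{\mathcal S}=K$,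 and there is an $8$-ary quantum code $[[586,K,d]]$. 3. For each of the (previously tabulated) parameters $[[N,K,D]]$ in the list $[[589,553,4]]$, $[[589,513,6]]$, $[[627,561,5]]$, $[[627,531,6]]$, $[[627,501,7]]$, $[[629,557,6]]$, $[[629,533,7]]$, $[[629,521,8]]$, there is an $8$-ary quantum code $[[586,K',D]]$ with the same distance $D$, larger dimension $K'>K$, and smaller length $586<N$. -/

import Mathlib

open Polynomial

/-! ### Cyclotomic cosets -/

/-- The `q`-cyclotomic coset `S_a = {a q^i mod n : i = 0, 1, 2, …}` modulo `n`. -/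
def cyclotomicCoset (q n : ℕ) (a : ZMod n) : Set (ZMod n) :=
  Set.range fun i : ℕ => a * (q : ZMod n) ^ i

/-- The set of all `q`-cyclotomic cosets modulo `n`. -/
def allCosets (q n : ℕ) : Set (Set (ZMod n)) :=
  Set.range (cyclotomicCoset q n)

/-- For a set `𝒮 = {S_a}` of cosets, the set `l𝒮 = {S_{la}}`. -/
def scaleCosets (q n l : ℕ) (𝒮 : Set (Set (ZMod n))) : Set (Set (ZMod n)) :=
  {B | ∃ a : ZMod n, cyclotomicCoset q n a ∈ 𝒮 ∧ B = cyclotomicCoset q n ((l : ZMod n) * a)}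

/-- The set `𝒮^*` of the duals of the cosets in `𝒮`: two cosets `A` and `B` are dual if `a + b = 0`
modulo `n` for some `a ∈ A` and `b ∈ B`. -/
def dualCosets (q n : ℕ) (𝒮 : Set (Set (ZMod n))) : Set (Set (ZMod n)) :=
  {B | B ∈ allCosets q n ∧ ∃ A ∈ 𝒮, ∃ a ∈ A, ∃ b ∈ B, a + b = 0}

/-- The set `𝒯 = {{0}} ∪ (𝒜 - (l𝒮)^*)`, where `𝒜` is the set of all cosets. -/
def hermitianDualCosets (q n l : ℕ) (𝒮 : Set (Set (ZMod n))) : Set (Set (ZMod n)) :=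
  {({0} : Set (ZMod n))} ∪ (allCosets q n \ dualCosets q n (scaleCosets q n l 𝒮))

/-- The conditions on `𝒮` under which the construction yields an `l`-ary quantum code of length
`n + 1` and designed distance `d` (here `q = l ^ 2`): `𝒮` is a set of `q`-cyclotomic cosets modulo
`n` containing `{0}`, the set `(l𝒮)^*` contains all `S_a` with `n + 2 - d ≤ a ≤ n - 1`, and
`𝒮 ⊆ 𝒯`. -/
def IsAdmissible (q n l d : ℕ) (𝒮 : Set (Set (ZMod n))) : Prop :=
  𝒮 ⊆ allCosets q n ∧ ({0} : Set (ZMod n)) ∈ 𝒮 ∧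
    (∀ a : ℕ, n + 2 ≤ a + d → a + 1 ≤ n →
      cyclotomicCoset q n (a : ZMod n) ∈ dualCosets q n (scaleCosets q n l 𝒮)) ∧
    𝒮 ⊆ hermitianDualCosets q n l 𝒮

/-! ### The classical polynomial codes -/

section PolynomialCode

variable (q n : ℕ) (F K : Type) [Field F] [Field K] [Algebra F K]

/-- The polynomial `∑_{i < s_a} (γ x^a)^(q^i)`, where `s_a` is the size of the coset `S_a`. -/
noncomputable def cosetPoly (a : ZMod n) (γ : K) : K[X] :=
  ∑ i ∈ Finset.range (cyclotomicCoset q n a).ncard, (C γ * X ^ a.val) ^ q ^ i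

/-- The `F`-space `V_𝒮` spanned by the polynomials `cosetPoly a γ` with `S_a ∈ 𝒮` and `γ` in the
subfield with `q ^ s_a` elements of `K`. (Letting `γ` run through an `F`-basis of that subfield
gives the same span.) -/
noncomputable def polySpace (𝒮 : Set (Set (ZMod n))) : Submodule F K[X] :=
  Submodule.span F {f | ∃ (a : ZMod n) (γ : K), cyclotomicCoset q n a ∈ 𝒮 ∧
    γ ^ q ^ (cyclotomicCoset q n a).ncard = γ ∧ f = cosetPoly q n K a γ}

/-- The evaluation points: `0` and the `n`-th roots of unity in `K`. -/
abbrev EvalPoint : Type := {β : K // β = 0 ∨ β ^ n = 1}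

/-- Evaluation of polynomials over `K` at all evaluation points, as an `F`-linear map. -/
noncomputable def evalPoints : K[X] →ₗ[F] (EvalPoint n K → K) :=
  LinearMap.pi fun β => (Polynomial.aeval (R := K) β.1).toLinearMap.restrictScalars F

/-- The code `C_𝒮 = {(f(β))_β : f ∈ V_𝒮}` over `F`, as a subspace of the space of words with
letters in `F` indexed by the evaluation points. -/
noncomputable def polyCode (𝒮 : Set (Set (ZMod n))) : Submodule F (EvalPoint n K → F) :=
  ((polySpace q n F K 𝒮).map (evalPoints n F K)).comap
    ((Algebra.linearMap F K).compLeft (EvalPoint n K))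

end PolynomialCode

/-! ### Quantum codes -/

section QuantumCode

variable {ι α : Type} [Fintype ι] [DecidableEq ι] [Fintype α] [DecidableEq α]

/-- The operator with matrix `E` on the state space of a system with sites `ι`, each of which is
a qudit with orthonormal basis `α`, acts only on the sites in `A`: it has the form `N ⊗ 1`, with
`N` acting on the sites in `A` and the identity on the other sites. -/
def ActsOnlyOn (A : Finset ι) (E : Matrix (ι → α) (ι → α) ℂ) : Prop :=
  ∃ N : Matrix (A → α) (A → α) ℂ, ∀ x y : ι → α,
    E x y = if ∀ i, i ∉ A → x i = y i then N (fun i => x i) (fun i => y i) else 0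

/-- The quantum code `Q` detects the error `E` (the Knill-Laflamme condition `P E P = c P`,
with `P` the orthogonal projection onto `Q`). -/
def Detects (Q : Submodule ℂ (EuclideanSpace ℂ (ι → α)))
    (E : Matrix (ι → α) (ι → α) ℂ) : Prop :=
  ∃ c : ℂ, ∀ u ∈ Q, ∀ v ∈ Q, inner ℂ u (Matrix.toEuclideanLin E v) = c * inner ℂ u v

/-- The minimum distance of the quantum code `Q` is `d`: the code detects all errors that act on
fewer than `d` sites, and `d` is the largest number with this property. -/
def HasMinDistance (Q : Submodule ℂ (EuclideanSpace ℂ (ι → α))) (d : ℕ) : Prop :=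
  IsGreatest {e : ℕ | ∀ (A : Finset ι) (E : Matrix (ι → α) (ι → α) ℂ),
    A.card < e → ActsOnlyOn A E → Detects Q E} d

end QuantumCode

/-- There is an `l`-ary quantum code with parameters `[[N, k, d]]`: a subspace of dimension `l ^ k`
of the state space `(ℂ^l)^{⊗ N}` of `N` qudits whose minimum distance is `d`. -/
def ExistsQuantumCode (l N k d : ℕ) : Prop :=
  ∃ Q : Submodule ℂ (EuclideanSpace ℂ (Fin N → Fin l)),
    Module.finrank ℂ Q = l ^ k ∧ HasMinDistance Q d

set_option linter.unusedSectionVars false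

/-! ### Errors and distances of quantum codes -/

section QuantumDistance

variable {ι α : Type} [Fintype ι] [DecidableEq ι] [Fintype α] [DecidableEq α]

/-! All parameters come from one family indexed by m ≤ 13, with K = 584 − 4m and d = m + 2. The set
of cosets is `traceCosets m`, consisting of the S_{8j} with j ≤ m. Since 64² = 1 modulo 585, cosets
have the form {a, 64a} and the polynomials of a nonzero coset here are traces, so C_𝒮 is the code of
words c + ∑_j Tr(γ_j β^{8j}) over F_64 (`polyCode_traceCosets`), of dimension 1 + 2m
(`traceWord_injective`).

Two facts make this a quantum code. First, the code is Hermitian self-orthogonal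
(`sum_traceWord_mul_pow`): power sums over the 586 evaluation points vanish for exponent 0, because
586 is even, and for exponents not divisible by 585, and every exponent that occurs is of one of
these kinds. Second, the code restricts onto all words on any m + 1 points (`exists_traceWord_eq`),
by interpolation in the variable β^8; equivalently its dual has minimum distance at least m + 2.

In a basis 1, ω of F_64 over F_8 the skew-Hermitian form is a multiple of the symplectic one
(`exists_symplectic_coordinates`), so the words label commuting Weyl operators. A common eigenspace
has dimension at least 8^586 / 8^(2 + 4m) (`exists_common_eigenspace`). For an error on at most m +
1 sites, averaging over conjugation by the whole group is averaging over all Weyl operators on those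
sites, which leaves a scalar (`exists_twirl_eq`). The group acts by scalars on the eigenspace, so
the error is detected there.

This bounds the distance only from below, whereas exact distance is required. Since detection passes
to subspaces, the dimension can be cut down to 8^K. If the distance exceeds d, an invertible
operator on one site lowers it by exactly one (`exists_detectsBelow_pred`); repeating this reaches d
(`exists_hasMinDistance`). -/

theorem inner_toEuclideanLin {X : Type} [Fintype X] [DecidableEq X] (E : Matrix X X ℂ)
    (u v : EuclideanSpace ℂ X) :
    inner ℂ u (Matrix.toEuclideanLin E v) = ∑ x, ∑ y, star (u x) * (E x y * v y) := by
  simp only [PiLp.inner_apply, RCLike.inner_apply, Matrix.toLpLin_apply, Matrix.mulVec, dotProduct]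
  refine Finset.sum_congr rfl fun x _ => ?_
  rw [mul_comm, Finset.mul_sum]
  rfl

theorem toEuclideanLin_mul_apply {X : Type} [Fintype X] [DecidableEq X] (M E : Matrix X X ℂ)
    (v : EuclideanSpace ℂ X) : Matrix.toEuclideanLin (M * E) v =
      Matrix.toEuclideanLin M (Matrix.toEuclideanLin E v) := by
  simp [Matrix.toLpLin_apply, Matrix.mulVec_mulVec]

theorem inner_toEuclideanLin_left {X : Type} [Fintype X] [DecidableEq X] (M E : Matrix X X ℂ)
    (u v : EuclideanSpace ℂ X) :
    inner ℂ (Matrix.toEuclideanLin M u) (Matrix.toEuclideanLin E v) =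
      inner ℂ u (Matrix.toEuclideanLin (M.conjTranspose * E) v) := by
  rw [← LinearMap.adjoint_inner_right, ← Matrix.toEuclideanLin_conjTranspose_eq_adjoint,
    toEuclideanLin_mul_apply]

/-- The quantum code `Q` detects all errors that act on fewer than `d` sites. -/
def DetectsBelow (Q : Submodule ℂ (EuclideanSpace ℂ (ι → α))) (d : ℕ) : Prop :=
  ∀ (A : Finset ι) (E : Matrix (ι → α) (ι → α) ℂ), A.card < d → ActsOnlyOn A E → Detects Q E

theorem DetectsBelow.mono_right {Q : Submodule ℂ (EuclideanSpace ℂ (ι → α))} {d e : ℕ}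
    (h : DetectsBelow Q d) (hed : e ≤ d) : DetectsBelow Q e :=
  fun A E hA hE => h A E (hA.trans_le hed) hE

theorem DetectsBelow.mono_left {Q Q' : Submodule ℂ (EuclideanSpace ℂ (ι → α))} {d : ℕ}
    (h : DetectsBelow Q d) (hQ : Q' ≤ Q) : DetectsBelow Q' d := fun A E hA hE => by
  obtain ⟨c, hc⟩ := h A E hA hE
  exact ⟨c, fun u hu v hv => hc u (hQ hu) v (hQ hv)⟩

theorem hasMinDistance_of_detectsBelow {Q : Submodule ℂ (EuclideanSpace ℂ (ι → α))} {d : ℕ}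
    (h : DetectsBelow Q d) (h' : ¬ DetectsBelow Q (d + 1)) : HasMinDistance Q d := by
  refine ⟨h, fun e he => ?_⟩
  by_contra hlt
  exact h' (DetectsBelow.mono_right (d := e) he (by omega))

theorem Detects.smul {Q : Submodule ℂ (EuclideanSpace ℂ (ι → α))}
    {E : Matrix (ι → α) (ι → α) ℂ} (h : Detects Q E) (z : ℂ) : Detects Q (z • E) := by
  obtain ⟨c, hc⟩ := h
  refine ⟨z * c, fun u hu v hv => ?_⟩
  rw [map_smul, LinearMap.smul_apply, inner_smul_right, hc u hu v hv, mul_assoc]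

theorem Detects.sum {Q : Submodule ℂ (EuclideanSpace ℂ (ι → α))} {κ : Type} (s : Finset κ)
    {E : κ → Matrix (ι → α) (ι → α) ℂ} (h : ∀ k ∈ s, Detects Q (E k)) :
    Detects Q (∑ k ∈ s, E k) := by
  choose! c hc using h
  refine ⟨∑ k ∈ s, c k, fun u hu v hv => ?_⟩
  rw [map_sum, LinearMap.sum_apply, inner_sum, Finset.sum_mul]
  exact Finset.sum_congr rfl fun k hk => hc k hk u hu v hv

/-- An operator acts only on the sites in `A` if and only if its matrix entries vanish between
states that differ outside `A`, and depend only on the letters in `A` otherwise. -/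
theorem actsOnlyOn_iff {A : Finset ι} {E : Matrix (ι → α) (ι → α) ℂ} [Nonempty α] :
    ActsOnlyOn A E ↔
      (∀ x y, (∃ i, i ∉ A ∧ x i ≠ y i) → E x y = 0) ∧
      ∀ x y x' y', (∀ i, i ∉ A → x i = y i) → (∀ i, i ∉ A → x' i = y' i) →
        (∀ i ∈ A, x i = x' i) → (∀ i ∈ A, y i = y' i) → E x y = E x' y' := by
  constructor
  · rintro ⟨N, hN⟩
    refine ⟨fun x y ⟨i, hi, hxy⟩ => ?_, fun x y x' y' h h' hx hy => ?_⟩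
    · rw [hN, if_neg fun h => hxy (h i hi)]
    · rw [hN, hN, if_pos h, if_pos h']
      congr 1
      · exact funext fun i => hx i i.2
      · exact funext fun i => hy i i.2
  · rintro ⟨h₁, h₂⟩
    let c : α := Classical.arbitrary α
    let ext : (A → α) → ι → α := fun p i => if h : i ∈ A then p ⟨i, h⟩ else c
    refine ⟨fun p q => E (ext p) (ext q), fun x y => ?_⟩
    split_ifs with h
    · apply h₂ _ _ _ _ h
      · intro i hi
        simp [ext, hi]
      · intro i hi
        simp [ext, hi]
      · intro i hi
        simp [ext, hi]
    · push Not at h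
      exact h₁ x y h

/-- The operator `|a⟩⟨b|` on the site `i`. -/
def siteUnit (i : ι) (a b : α) : Matrix (ι → α) (ι → α) ℂ :=
  Matrix.of fun x y => if x i = a ∧ y = Function.update x i b then 1 else 0

theorem siteUnit_apply (i : ι) (a b : α) (x y : ι → α) :
    siteUnit i a b x y = if x i = a ∧ y = Function.update x i b then 1 else 0 :=
  rfl

theorem siteUnit_apply' (i : ι) (a b : α) (x y : ι → α) :
    siteUnit i a b x y = if y i = b ∧ x = Function.update y i a then 1 else 0 := by
  rw [siteUnit_apply]
  refine if_congr ⟨?_, ?_⟩ rfl rfl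
  · rintro ⟨rfl, rfl⟩
    simp
  · rintro ⟨rfl, rfl⟩
    simp

theorem siteUnit_conjTranspose (i : ι) (a b : α) :
    (siteUnit i a b).conjTranspose = siteUnit i b a := by
  ext x y
  rw [Matrix.conjTranspose_apply, siteUnit_apply', siteUnit_apply]
  split_ifs <;> simp

theorem siteUnit_mul_apply (i : ι) (a b : α) (R : Matrix (ι → α) (ι → α) ℂ) (x y : ι → α) :
    (siteUnit i a b * R) x y = if x i = a then R (Function.update x i b) y else 0 := by
  rw [Matrix.mul_apply]
  by_cases h : x i = a <;> simp [siteUnit_apply, h]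

theorem mul_siteUnit_apply (i : ι) (a b : α) (R : Matrix (ι → α) (ι → α) ℂ) (x y : ι → α) :
    (R * siteUnit i a b) x y = if y i = b then R x (Function.update y i a) else 0 := by
  rw [Matrix.mul_apply]
  by_cases h : y i = b <;> simp [siteUnit_apply', h]

theorem siteUnit_mul_self (i : ι) (a b : α) :
    siteUnit i a b * siteUnit i a b = if a = b then siteUnit i a b else 0 := by
  ext x y
  rw [siteUnit_mul_apply]
  split_ifs with h₁ h₂ h₂
  · subst h₂
    rw [← h₁, Function.update_eq_self]
  · simp [siteUnit_apply, Ne.symm h₂]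
  · simp [siteUnit_apply, h₁]
  · rfl

theorem ActsOnlyOn.mono {A B : Finset ι} {E : Matrix (ι → α) (ι → α) ℂ} [Nonempty α]
    (h : ActsOnlyOn A E) (hAB : A ⊆ B) : ActsOnlyOn B E := by
  rw [actsOnlyOn_iff] at h ⊢
  refine ⟨fun x y ⟨i, hi, hxy⟩ => h.1 x y ⟨i, fun h => hi (hAB h), hxy⟩,
    fun x y x' y' h₁ h₂ hx hy => ?_⟩
  by_cases hA : ∀ i, i ∉ A → x i = y i
  · refine h.2 x y x' y' hA (fun i hi => ?_) (fun i hi => hx i (hAB hi))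
      fun i hi => hy i (hAB hi)
    by_cases hB : i ∈ B
    · rw [← hx i hB, ← hy i hB, hA i hi]
    · exact h₂ i hB
  · push Not at hA
    obtain ⟨i, hi, hne⟩ := hA
    rw [h.1 x y ⟨i, hi, hne⟩, h.1 x' y' ⟨i, hi, ?_⟩]
    by_cases hB : i ∈ B
    · rwa [← hx i hB, ← hy i hB]
    · exact absurd (h₁ i hB) hne

theorem ActsOnlyOn.add {A : Finset ι} {E E' : Matrix (ι → α) (ι → α) ℂ}
    (h : ActsOnlyOn A E) (h' : ActsOnlyOn A E') : ActsOnlyOn A (E + E') := by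
  obtain ⟨N, hN⟩ := h
  obtain ⟨N', hN'⟩ := h'
  refine ⟨N + N', fun x y => ?_⟩
  rw [Matrix.add_apply, hN, hN']
  split_ifs <;> simp

theorem ActsOnlyOn.smul {A : Finset ι} {E : Matrix (ι → α) (ι → α) ℂ}
    (h : ActsOnlyOn A E) (z : ℂ) : ActsOnlyOn A (z • E) := by
  obtain ⟨N, hN⟩ := h
  refine ⟨z • N, fun x y => ?_⟩
  rw [Matrix.smul_apply, hN]
  split_ifs <;> simp

theorem actsOnlyOn_one (A : Finset ι) [Nonempty α] :
    ActsOnlyOn A (1 : Matrix (ι → α) (ι → α) ℂ) := by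
  rw [actsOnlyOn_iff]
  refine ⟨fun x y ⟨i, _, hxy⟩ => Matrix.one_apply_ne fun h => hxy (congrFun h i),
    fun x y x' y' h h' hx hy => ?_⟩
  rw [Matrix.one_apply, Matrix.one_apply]
  refine if_congr ⟨?_, ?_⟩ rfl rfl <;> intro hxy <;> funext i <;> by_cases hi : i ∈ A
  · rw [← hx i hi, ← hy i hi, hxy]
  · exact h' i hi
  · rw [hx i hi, hy i hi, hxy]
  · exact h i hi

theorem ActsOnlyOn.mul_siteUnit {A : Finset ι} {E : Matrix (ι → α) (ι → α) ℂ} [Nonempty α]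
    (h : ActsOnlyOn A E) {i : ι} (hi : i ∈ A) (a b : α) : ActsOnlyOn A (E * siteUnit i a b) := by
  rw [actsOnlyOn_iff] at h ⊢
  have hne : ∀ j, j ∉ A → j ≠ i := fun j hj e => hj (e ▸ hi)
  refine ⟨fun x y ⟨j, hj, hxy⟩ => ?_, fun x y x' y' h₁ h₂ hx hy => ?_⟩
  · rw [mul_siteUnit_apply, h.1 _ _ ⟨j, hj, ?_⟩, ite_self]
    rwa [Function.update_of_ne (hne j hj)]
  · rw [mul_siteUnit_apply, mul_siteUnit_apply, hy i hi]
    split_ifs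
    · refine h.2 _ _ _ _ (fun j hj => ?_) (fun j hj => ?_) hx fun j hj => ?_
      · rw [Function.update_of_ne (hne j hj), h₁ j hj]
      · rw [Function.update_of_ne (hne j hj), h₂ j hj]
      · by_cases hji : j = i
        · subst hji
          simp
        · simp [hji, hy j hj]
    · rfl

theorem ActsOnlyOn.siteUnit_mul {A : Finset ι} {E : Matrix (ι → α) (ι → α) ℂ} [Nonempty α]
    (h : ActsOnlyOn A E) {i : ι} (hi : i ∈ A) (a b : α) : ActsOnlyOn A (siteUnit i a b * E) := by
  rw [actsOnlyOn_iff] at h ⊢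
  have hne : ∀ j, j ∉ A → j ≠ i := fun j hj e => hj (e ▸ hi)
  refine ⟨fun x y ⟨j, hj, hxy⟩ => ?_, fun x y x' y' h₁ h₂ hx hy => ?_⟩
  · rw [siteUnit_mul_apply, h.1 _ _ ⟨j, hj, ?_⟩, ite_self]
    rwa [Function.update_of_ne (hne j hj)]
  · rw [siteUnit_mul_apply, siteUnit_mul_apply, hx i hi]
    split_ifs
    · refine h.2 _ _ _ _ (fun j hj => ?_) (fun j hj => ?_) (fun j hj => ?_) hy
      · rw [Function.update_of_ne (hne j hj), h₁ j hj]
      · rw [Function.update_of_ne (hne j hj), h₂ j hj]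
      · by_cases hji : j = i
        · subst hji
          simp
        · simp [hji, hx j hj]
    · rfl

/-- The operator `1 + z |a⟩⟨b|` on the site `i`. -/
noncomputable def siteShear (i : ι) (a b : α) (z : ℂ) : Matrix (ι → α) (ι → α) ℂ :=
  1 + z • siteUnit i a b

theorem siteShear_conj (i : ι) (a b : α) (z : ℂ) (R : Matrix (ι → α) (ι → α) ℂ) :
    (siteShear i a b z).conjTranspose * (R * siteShear i a b z) =
      R + z • (R * siteUnit i a b) + star z • (siteUnit i b a * R) +
        (star z * z) • (siteUnit i b a * (R * siteUnit i a b)) := by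
  simp only [siteShear, Matrix.conjTranspose_add, Matrix.conjTranspose_one,
    Matrix.conjTranspose_smul, siteUnit_conjTranspose, mul_add, add_mul, one_mul, mul_one,
    Matrix.smul_mul, Matrix.mul_smul, smul_smul]
  rw [mul_comm z]
  abel

/-- The unit |a⟩⟨b| is idempotent for a = b and squares to zero for a ≠ b; in both cases a left
inverse 1 + w |a⟩⟨b| can be written down. -/
theorem siteShear_injective (i : ι) (a b : α) {z : ℂ} (hz : 1 + z ≠ 0) :
    Function.Injective (Matrix.toEuclideanLin (siteShear i a b z)) := by
  obtain ⟨w, hw⟩ : ∃ w : ℂ, (1 + w • siteUnit i a b) * siteShear i a b z = 1 := by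
    by_cases hab : a = b
    · refine ⟨-z / (1 + z), ?_⟩
      simp only [siteShear, mul_add, add_mul, one_mul, mul_one, Matrix.smul_mul, Matrix.mul_smul,
        siteUnit_mul_self, if_pos hab, add_assoc, ← add_smul, smul_smul]
      convert add_zero _ using 2
      convert zero_smul ℂ _ using 2
      field_simp
      ring
    · refine ⟨-z, ?_⟩
      simp [siteShear, mul_add, add_mul, siteUnit_mul_self, if_neg hab]
  intro u v huv
  have h := congrArg (Matrix.toEuclideanLin (1 + w • siteUnit i a b)) huv
  rw [← toEuclideanLin_mul_apply, ← toEuclideanLin_mul_apply, hw] at h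
  simpa [Matrix.toLpLin_apply] using h

/-- Polarization: summing over fourth roots of unity kills the constant, conjugate-linear and
quadratic terms of `siteShear_conj` and keeps the linear one. The modulus 2 of the parameter ensures
1 + z ≠ 0, so that every shear used is invertible. -/
theorem sum_siteShear_conj (i : ι) (a b : α) (R : Matrix (ι → α) (ι → α) ℂ) :
    ∑ k ∈ Finset.range 4, (Complex.I ^ k / 8) •
      ((siteShear i a b (2 * (-Complex.I) ^ k)).conjTranspose *
        (R * siteShear i a b (2 * (-Complex.I) ^ k))) = R * siteUnit i a b := by
  have hI2 : Complex.I ^ 2 = -1 := Complex.I_sq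
  have hI3 : Complex.I ^ 3 = -Complex.I := Complex.I_pow_three
  simp only [siteShear_conj, Finset.sum_range_succ, Finset.sum_range_zero, zero_add, smul_add,
    smul_smul]
  generalize R * siteUnit i a b = X
  generalize siteUnit i b a * R = Y
  generalize siteUnit i b a * X = Z
  simp only [pow_zero, pow_one, neg_sq, Odd.neg_pow (by decide : Odd 3), hI2, hI3, star_mul',
    Complex.star_def, map_neg, map_one, map_ofNat, Complex.conj_I]
  match_scalars <;> ring_nf <;> norm_num [hI2]

/-- This is the expansion of an operator in matrix units of one tensor factor; the coefficients act
on the remaining sites of `A`. -/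
theorem exists_sum_mul_siteUnit {A : Finset ι} {E : Matrix (ι → α) (ι → α) ℂ} [Nonempty α]
    (h : ActsOnlyOn A E) {i : ι} (hi : i ∈ A) :
    ∃ R : α → α → Matrix (ι → α) (ι → α) ℂ, (∀ a b, ActsOnlyOn (A.erase i) (R a b)) ∧
      E = ∑ p : α × α, R p.1 p.2 * siteUnit i p.1 p.2 := by
  let R (a b : α) : Matrix (ι → α) (ι → α) ℂ := Matrix.of fun x y => if x i = y i then
    E (Function.update x i a) (Function.update y i b) else 0
  have hRdef (a b : α) (x y : ι → α) : R a b x y = if x i = y i then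
    E (Function.update x i a) (Function.update y i b) else 0 := rfl
  refine ⟨R, fun a b => ?_, ?_⟩
  · rw [actsOnlyOn_iff] at h ⊢
    have hupd : ∀ (x x' : ι → α) (c : α), (∀ j ∈ A.erase i, x j = x' j) →
        ∀ j ∈ A, Function.update x i c j = Function.update x' i c j := by
      intro x x' c hx j hj
      by_cases hji : j = i
      · subst hji
        simp
      · simpa [hji] using hx j (Finset.mem_erase.2 ⟨hji, hj⟩)
    have hout : ∀ x y : ι → α, (∀ j, j ∉ A.erase i → x j = y j) → ∀ j, j ∉ A →
        Function.update x i a j = Function.update y i b j := by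
      intro x y hxy j hj
      have hji : j ≠ i := fun e => hj (e ▸ hi)
      simpa [hji] using hxy j fun h => hj (Finset.mem_of_mem_erase h)
    refine ⟨fun x y ⟨j, hj, hxy⟩ => ?_, fun x y x' y' h₁ h₂ hx hy => ?_⟩
    · rw [hRdef]
      split_ifs with hxyi
      · have hji : j ≠ i := fun e => hxy (e ▸ hxyi)
        refine h.1 _ _ ⟨j, fun hA => hj (Finset.mem_erase.2 ⟨hji, hA⟩), ?_⟩
        simpa [hji] using hxy
      · rfl
    · rw [hRdef, hRdef, if_pos (h₁ i (Finset.notMem_erase i A)),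
        if_pos (h₂ i (Finset.notMem_erase i A))]
      exact h.2 _ _ _ _ (hout _ _ h₁) (hout _ _ h₂) (hupd _ _ _ hx) (hupd _ _ _ hy)
  · ext x y
    rw [Matrix.sum_apply, Finset.sum_eq_single (x i, y i)]
    · simp [mul_siteUnit_apply, hRdef]
    · rintro ⟨a, b⟩ - hp
      rw [mul_siteUnit_apply, hRdef]
      split_ifs with hb hc
      · have : x i ≠ a := fun ha => hp (by rw [ha, hb])
        simp [this] at hc
      · rfl
      · rfl
    · simp

/-- If an invertible operator `M` on one site is applied to a code, then the new code detects `R`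
as soon as the old one detects `M* R M` and `M* M`. -/
theorem Detects.map {Q : Submodule ℂ (EuclideanSpace ℂ (ι → α))}
    {M R : Matrix (ι → α) (ι → α) ℂ} (hM : Function.Injective (Matrix.toEuclideanLin M))
    (h₁ : Detects Q (M.conjTranspose * M)) (h : Detects Q (M.conjTranspose * (R * M))) :
    Detects (Q.map (Matrix.toEuclideanLin M)) R := by
  obtain ⟨c₁, hc₁⟩ := h₁
  obtain ⟨c, hc⟩ := h
  have key : ∀ u v, inner ℂ (Matrix.toEuclideanLin M u)
      (Matrix.toEuclideanLin R (Matrix.toEuclideanLin M v)) =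
      inner ℂ u (Matrix.toEuclideanLin (M.conjTranspose * (R * M)) v) := fun u v => by
    rw [← inner_toEuclideanLin_left, toEuclideanLin_mul_apply]
  refine ⟨c / c₁, ?_⟩
  rintro _ ⟨u, hu, rfl⟩ _ ⟨v, hv, rfl⟩
  rw [key, inner_toEuclideanLin_left, hc u hu v hv, hc₁ u hu v hv]
  by_cases hu0 : u = 0
  · simp [hu0]
  · have hc₁0 : c₁ ≠ 0 := by
      rintro rfl
      have := hc₁ u hu u hu
      rw [← inner_toEuclideanLin_left, zero_mul, inner_self_eq_zero] at this
      exact hu0 (hM (by rw [this, map_zero]))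
    field_simp

theorem Detects.of_map {Q : Submodule ℂ (EuclideanSpace ℂ (ι → α))}
    {M R : Matrix (ι → α) (ι → α) ℂ} (h₁ : Detects Q (M.conjTranspose * M))
    (h : Detects (Q.map (Matrix.toEuclideanLin M)) R) :
    Detects Q (M.conjTranspose * (R * M)) := by
  obtain ⟨c₁, hc₁⟩ := h₁
  obtain ⟨c, hc⟩ := h
  refine ⟨c * c₁, fun u hu v hv => ?_⟩
  have := hc _ ⟨u, hu, rfl⟩ _ ⟨v, hv, rfl⟩
  rw [inner_toEuclideanLin_left M M, hc₁ u hu v hv] at this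
  rw [mul_assoc, ← this, ← inner_toEuclideanLin_left, toEuclideanLin_mul_apply]

theorem actsOnlyOn_siteShear_conj {A : Finset ι} {R : Matrix (ι → α) (ι → α) ℂ} [Nonempty α]
    (h : ActsOnlyOn A R) (i : ι) (a b : α) (z : ℂ) :
    ActsOnlyOn (insert i A) ((siteShear i a b z).conjTranspose * (R * siteShear i a b z)) := by
  have h := h.mono (Finset.subset_insert i A)
  have hi := Finset.mem_insert_self i A
  rw [siteShear_conj]
  exact ((h.add ((h.mul_siteUnit hi a b).smul z)).add ((h.siteUnit_mul hi b a).smul _)).add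
    (((h.mul_siteUnit hi a b).siteUnit_mul hi b a).smul _)

/-- A code of minimum distance `e + 1 ≥ 2` can be changed by an invertible operator on one site
into a code of minimum distance `e`. -/
theorem exists_detectsBelow_pred [Nonempty α] {Q : Submodule ℂ (EuclideanSpace ℂ (ι → α))} {e : ℕ}
    (he : 1 ≤ e) (h : DetectsBelow Q (e + 1)) (h' : ¬ DetectsBelow Q (e + 2)) :
    ∃ Q' : Submodule ℂ (EuclideanSpace ℂ (ι → α)),
      Module.finrank ℂ Q' = Module.finrank ℂ Q ∧ DetectsBelow Q' e ∧ ¬ DetectsBelow Q' (e + 1) := by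
  unfold DetectsBelow at h'
  push Not at h'
  obtain ⟨A, E, hA, hE, hQ⟩ := h'
  have hne : A.Nonempty := by
    rw [Finset.nonempty_iff_ne_empty]
    rintro rfl
    exact hQ (h ∅ E (by simp) hE)
  obtain ⟨i, hi⟩ := hne
  obtain ⟨R, hR, hsum⟩ := exists_sum_mul_siteUnit hE hi
  obtain ⟨⟨a, b⟩, hab⟩ : ∃ p : α × α, ¬ Detects Q (R p.1 p.2 * siteUnit i p.1 p.2) := by
    by_contra hcon
    push Not at hcon
    exact hQ (hsum ▸ Detects.sum _ fun p _ => hcon p)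
  -- By polarization the undetected term is a combination of conjugates M* R M, so at least one of
  -- these is undetected.
  obtain ⟨k, hk⟩ : ∃ k : ℕ, ¬ Detects Q
      ((siteShear i a b (2 * (-Complex.I) ^ k)).conjTranspose *
        (R a b * siteShear i a b (2 * (-Complex.I) ^ k))) := by
    by_contra hcon
    push Not at hcon
    exact hab (sum_siteShear_conj i a b (R a b) ▸ Detects.sum _ fun k _ => (hcon k).smul _)
  set M := siteShear i a b (2 * (-Complex.I) ^ k) with hMdef
  have hM : Function.Injective (Matrix.toEuclideanLin M) := by
    refine siteShear_injective i a b fun hz => ?_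
    have h2 : ‖(2 * (-Complex.I) ^ k : ℂ)‖ = ‖(-1 : ℂ)‖ := by
      rw [eq_neg_of_add_eq_zero_right hz]
    simp at h2
  -- M* M acts on the single site `i`, hence is detected because `1 ≤ e`.
  have h₁ : Detects Q (M.conjTranspose * M) := by
    have := actsOnlyOn_siteShear_conj (actsOnlyOn_one (α := α) (∅ : Finset ι)) i a b
      (2 * (-Complex.I) ^ k)
    rw [one_mul] at this
    exact h _ _ (by simpa using Nat.succ_le_iff.1 he) this
  refine ⟨Q.map (Matrix.toEuclideanLin M), ?_, fun B S hB hS => ?_, fun hdet => hk ?_⟩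
  · exact (Submodule.equivMapOfInjective _ hM Q).finrank_eq.symm
  -- Conjugation by M adds at most the site `i` to the support, which costs one in the distance.
  · refine Detects.map hM h₁ (h (insert i B) _ ?_ (actsOnlyOn_siteShear_conj hS i a b _))
    exact (Finset.card_insert_le i B).trans_lt (by omega)
  -- The operator `R a b` witnesses the upper bound: it acts on at most `e` sites, and the new code
  -- cannot detect it because the old one does not detect M* R M.
  · refine Detects.of_map h₁ (hdet (A.erase i) (R a b) ?_ (hR a b))
    rw [Finset.card_erase_of_mem hi]
    omega

/-- For orthogonal unit vectors u, v of the code, a matrix unit |x⟩⟨y| with u(x) ≠ 0 and v(y) ≠ 0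
has a nonzero matrix element between them and so violates the Knill–Laflamme condition. This starts
the descent on the distance. -/
theorem not_detectsBelow_of_one_lt_finrank {Q : Submodule ℂ (EuclideanSpace ℂ (ι → α))}
    (hQ : 1 < Module.finrank ℂ Q) : ¬ DetectsBelow Q (Fintype.card ι + 1) := by
  intro h
  let b := stdOrthonormalBasis ℂ Q
  let u := b ⟨0, by omega⟩
  let v := b ⟨1, hQ⟩
  have huv : inner ℂ (u : EuclideanSpace ℂ (ι → α)) v = 0 :=
    b.orthonormal.2 (by simp)
  have hne : ∀ w, ∃ x, (b w : EuclideanSpace ℂ (ι → α)) x ≠ 0 := fun w => by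
    by_contra hcon
    push Not at hcon
    have : b w = 0 := Subtype.ext (PiLp.ext hcon)
    simpa [this] using b.orthonormal.1 w
  obtain ⟨x, hx⟩ := hne ⟨0, by omega⟩
  obtain ⟨y, hy⟩ := hne ⟨1, hQ⟩
  obtain ⟨c, hc⟩ := h Finset.univ (Matrix.single x y 1) (by simp)
    ⟨fun p q => Matrix.single x y 1 (fun i => p ⟨i, Finset.mem_univ i⟩)
      (fun i => q ⟨i, Finset.mem_univ i⟩), fun x y => by simp⟩
  have := hc u u.2 v v.2
  rw [huv, mul_zero, inner_toEuclideanLin, Finset.sum_eq_single x, Finset.sum_eq_single y] at this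
  · simp [u, v, hx, hy] at this
  · intro z _ hz
    simp [Matrix.single_apply_of_ne, Ne.symm hz]
  · simp
  · intro z _ hz
    refine Finset.sum_eq_zero fun w _ => ?_
    simp [Matrix.single_apply_of_ne, Ne.symm hz]
  · simp

/-- A code of dimension at least two that detects all errors on fewer than `d` sites can be
replaced by a code of the same dimension whose minimum distance is exactly `d`. -/
theorem exists_hasMinDistance [Nonempty α] {Q : Submodule ℂ (EuclideanSpace ℂ (ι → α))} {d : ℕ}
    (hd : 1 ≤ d) (hQ : 1 < Module.finrank ℂ Q) (h : DetectsBelow Q d) :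
    ∃ Q' : Submodule ℂ (EuclideanSpace ℂ (ι → α)),
      Module.finrank ℂ Q' = Module.finrank ℂ Q ∧ HasMinDistance Q' d := by
  have key : ∀ (n : ℕ) (P : Submodule ℂ (EuclideanSpace ℂ (ι → α))), DetectsBelow P d →
      ¬ DetectsBelow P (d + 1 + n) → ∃ Q' : Submodule ℂ (EuclideanSpace ℂ (ι → α)),
        Module.finrank ℂ Q' = Module.finrank ℂ P ∧ HasMinDistance Q' d := by
    intro n
    induction n with
    | zero => exact fun P hP hP' => ⟨P, rfl, hasMinDistance_of_detectsBelow hP hP'⟩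
    | succ n ih =>
      intro P hP hP'
      by_cases hPn : DetectsBelow P (d + 1 + n)
      · obtain ⟨P', hfin, h₁, h₂⟩ := exists_detectsBelow_pred (e := d + n) (by omega)
          (by convert hPn using 1; omega) (by convert hP' using 2; omega)
        obtain ⟨Q', hfin', hQ'⟩ := ih P' (h₁.mono_right (by omega)) (by convert h₂ using 2; omega)
        exact ⟨Q', hfin'.trans hfin, hQ'⟩
      · exact ih P hP hPn
  exact key (Fintype.card ι) Q h fun hcon =>
    not_detectsBelow_of_one_lt_finrank hQ (hcon.mono_right (by omega))

end QuantumDistance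

/-! ### Stabilizer codes -/

section StabilizerCode

/-- A family of `|s|` commuting operators with scalar squares acts by scalars on a subspace of
codimension at most `2 ^ |s|` (as a factor of the dimension). -/
theorem exists_common_eigenspace {V κ : Type} [AddCommGroup V] [Module ℂ V]
    [FiniteDimensional ℂ V] (T : κ → V →ₗ[ℂ] V) (hcomm : ∀ i j v, T i (T j v) = T j (T i v))
    (hsq : ∀ i, ∃ c : ℂ, c ≠ 0 ∧ ∀ v, T i (T i v) = c • v) (s : Finset κ) :
    ∃ W : Submodule ℂ V, (∀ i, ∀ v ∈ W, T i v ∈ W) ∧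
      (∀ i ∈ s, ∃ μ : ℂ, ∀ v ∈ W, T i v = μ • v) ∧
      Module.finrank ℂ V ≤ 2 ^ s.card * Module.finrank ℂ W := by
  classical
  induction s using Finset.induction_on with
  | empty => exact ⟨⊤, by simp, by simp, by simp⟩
  | insert k s hk ih =>
    obtain ⟨W, hinv, hscal, hdim⟩ := ih
    obtain ⟨c, hc, hTc⟩ := hsq k
    obtain ⟨μ, hμ⟩ := IsAlgClosed.exists_pow_nat_eq c (n := 2) (by norm_num)
    have hμ0 : μ ≠ 0 := by
      rintro rfl
      exact hc (by simpa using hμ.symm)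
    let P (ν : ℂ) : Submodule ℂ V := W ⊓ LinearMap.ker (T k - ν • LinearMap.id)
    have hP : ∀ ν v, v ∈ P ν ↔ v ∈ W ∧ T k v = ν • v := fun ν v => by
      simp [P, sub_eq_zero]
    -- Since `T k` squares to μ², W is the sum of the two eigenspaces for ±μ; one of them has at
    -- least half the dimension.
    have hle : W ≤ P μ ⊔ P (-μ) := by
      intro v hv
      rw [Submodule.mem_sup]
      refine ⟨(2⁻¹ : ℂ) • (v + μ⁻¹ • T k v), ?_, (2⁻¹ : ℂ) • (v - μ⁻¹ • T k v), ?_, by module⟩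
      · refine (hP _ _).2 ⟨W.smul_mem _ (W.add_mem hv (W.smul_mem _ (hinv k v hv))), ?_⟩
        rw [map_smul, map_add, map_smul, hTc, ← hμ]
        match_scalars <;> field_simp
      · refine (hP _ _).2 ⟨W.smul_mem _ (W.sub_mem hv (W.smul_mem _ (hinv k v hv))), ?_⟩
        rw [map_smul, map_sub, map_smul, hTc, ← hμ]
        match_scalars <;> field_simp
    have hfin : Module.finrank ℂ W ≤ Module.finrank ℂ (P μ) + Module.finrank ℂ (P (-μ)) :=
      (Submodule.finrank_mono hle).trans (Submodule.finrank_add_le_finrank_add_finrank _ _)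
    obtain ⟨ν, hν⟩ : ∃ ν, Module.finrank ℂ W ≤ 2 * Module.finrank ℂ (P ν) := by
      by_contra hcon
      push Not at hcon
      have h₁ := hcon μ
      have h₂ := hcon (-μ)
      omega
    refine ⟨P ν, fun i v hv => ?_, fun i hi => ?_, ?_⟩
    · obtain ⟨hvW, hvν⟩ := (hP _ _).1 hv
      exact (hP _ _).2 ⟨hinv i v hvW, by rw [hcomm, hvν, map_smul]⟩
    · rcases Finset.mem_insert.1 hi with rfl | hi
      · exact ⟨ν, fun v hv => ((hP _ _).1 hv).2⟩
      · obtain ⟨lam, hlam⟩ := hscal i hi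
        exact ⟨lam, fun v hv => hlam v ((hP _ _).1 hv).1⟩
    · rw [Finset.card_insert_of_notMem hk, pow_succ, mul_assoc]
      exact hdim.trans (Nat.mul_le_mul_left _ hν)

/-! ### Weyl operators in characteristic two. -/

variable {ι α : Type} [Fintype ι] [DecidableEq ι] [Field α] [Fintype α] [DecidableEq α] [CharP α 2]

theorem pi_add_self_char_two (x : ι → α) : x + x = 0 :=
  funext fun i => CharTwo.add_self_eq_zero (x i)

theorem add_add_cancel_char_two (x a : ι → α) : x + a + a = x := by
  rw [add_assoc, pi_add_self_char_two, add_zero]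

/-- The Weyl operator `f ↦ (x ↦ χ(b ⬝ x) f(x + a))` in characteristic two. -/
noncomputable def weyl (χ : AddChar α ℂ) (a b : ι → α) :
    EuclideanSpace ℂ (ι → α) →ₗ[ℂ] EuclideanSpace ℂ (ι → α) where
  toFun v := WithLp.toLp 2 fun x => χ (b ⬝ᵥ x) * v (x + a)
  map_add' v w := by
    ext x
    simp [mul_add]
  map_smul' c v := by
    ext x
    simp [mul_left_comm]

@[simp]
theorem weyl_apply (χ : AddChar α ℂ) (a b : ι → α) (v : EuclideanSpace ℂ (ι → α)) (x : ι → α) :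
    weyl χ a b v x = χ (b ⬝ᵥ x) * v (x + a) :=
  rfl

/-- Exchanging the factors changes the scalar from χ(b' ⬝ a) to χ(b ⬝ a'), so isotropy for the
symplectic form gives commuting operators. -/
theorem weyl_weyl (χ : AddChar α ℂ) (a b a' b' : ι → α) (v : EuclideanSpace ℂ (ι → α)) :
    weyl χ a b (weyl χ a' b' v) = χ (b' ⬝ᵥ a) • weyl χ (a + a') (b + b') v := by
  ext x
  simp only [weyl_apply, PiLp.smul_apply, smul_eq_mul, dotProduct_add, add_dotProduct,
    AddChar.map_add_eq_mul, add_assoc]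
  ring

theorem star_addChar_char_two (χ : AddChar α ℂ) (t : α) : star (χ t) = χ t := by
  rw [Complex.star_def, ← AddChar.map_neg_eq_conj, CharTwo.neg_eq]

theorem addChar_mul_self_char_two (χ : AddChar α ℂ) (t : α) : χ t * χ t = 1 := by
  rw [← AddChar.map_add_eq_mul, CharTwo.add_self_eq_zero, AddChar.map_zero_eq_one]

theorem inner_weyl_weyl (χ : AddChar α ℂ) (a b : ι → α) (E : Matrix (ι → α) (ι → α) ℂ)
    (u v : EuclideanSpace ℂ (ι → α)) :
    inner ℂ (weyl χ a b u) (Matrix.toEuclideanLin E (weyl χ a b v)) =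
      ∑ x, ∑ y, star (u x) * ((χ (b ⬝ᵥ (x + y)) * E (x + a) (y + a)) * v y) := by
  rw [inner_toEuclideanLin, ← Equiv.sum_comp (Equiv.addRight a)]
  refine Finset.sum_congr rfl fun x _ => ?_
  rw [← Equiv.sum_comp (Equiv.addRight a)]
  refine Finset.sum_congr rfl fun y _ => ?_
  simp only [Equiv.coe_addRight, weyl_apply, add_add_cancel_char_two, star_mul',
    star_addChar_char_two, dotProduct_add, AddChar.map_add_eq_mul]
  linear_combination (χ (b ⬝ᵥ x) * star (u x) * E (x + a) (y + a) * χ (b ⬝ᵥ y) * v y) *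
    addChar_mul_self_char_two χ (b ⬝ᵥ a)

/-! ### Twirling over a group of Weyl operators. -/

variable {G : Type} [AddCommGroup G] [Fintype G]

/-- If a group of Weyl operators restricts onto all Weyl operators on the sites in `A`, then
averaging over the group turns an operator on the sites in `A` into a scalar. -/
theorem exists_twirl_eq {χ : AddChar α ℂ} (hχ : χ.IsPrimitive) (pa pb : G →+ (ι → α))
    {A : Finset ι} (hA : ∀ a b : ι → α, ∃ g, ∀ i ∈ A, pa g i = a i ∧ pb g i = b i)
    {E : Matrix (ι → α) (ι → α) ℂ} (hE : ActsOnlyOn A E) :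
    ∃ c : ℂ, ∀ x y, ∑ g, χ (pb g ⬝ᵥ (x + y)) * E (x + pa g) (y + pa g) =
      if x = y then c else 0 := by
  rw [actsOnlyOn_iff] at hE
  refine ⟨∑ g, E (0 + pa g) (0 + pa g), fun x y => ?_⟩
  split_ifs with hxy
  · subst hxy
    -- Translating the summation by an element that shifts by x on `A` shows that the diagonal entry
    -- does not depend on x.
    obtain ⟨h, hh⟩ := hA x 0
    rw [← Equiv.sum_comp (Equiv.addRight h)]
    refine Finset.sum_congr rfl fun g _ => ?_
    rw [pi_add_self_char_two, dotProduct_zero, AddChar.map_zero_eq_one, one_mul]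
    refine hE.2 _ _ _ _ (fun _ _ => rfl) (fun _ _ => rfl) ?_ ?_ <;>
    · intro i hi
      simp only [Equiv.coe_addRight, map_add, Pi.add_apply, (hh i hi).1, Pi.zero_apply]
      linear_combination CharTwo.add_self_eq_zero (x i)
  · by_cases hout : ∃ i, i ∉ A ∧ x i ≠ y i
    · obtain ⟨i, hi, hne⟩ := hout
      exact Finset.sum_eq_zero fun g _ => by
        rw [hE.1 _ _ ⟨i, hi, by simpa using hne⟩, mul_zero]
    · push Not at hout
      obtain ⟨i, hne⟩ := Function.ne_iff.1 hxy
      have hi : i ∈ A := by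
        by_contra hi
        exact hne (hout i hi)
      have hxyi : x i + y i ≠ 0 := fun h => hne (by rwa [CharTwo.add_eq_zero] at h)
      obtain ⟨t, ht⟩ : ∃ t, χ (t * (x i + y i)) ≠ 1 := by
        obtain ⟨t, ht⟩ := AddChar.ne_one_iff.1 (hχ hxyi)
        exact ⟨t, by rwa [AddChar.mulShift_apply, mul_comm] at ht⟩
      -- Translation by an element that acts on `A` as a pure phase at `i` multiplies the
      -- off-diagonal sum by a number different from 1, so the sum is zero.
      obtain ⟨h, hh⟩ := hA 0 (Pi.single i t)
      have hdot : pb h ⬝ᵥ (x + y) = t * (x i + y i) := by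
        rw [dotProduct, Finset.sum_eq_single i]
        · simp [(hh i hi).2]
        · intro j _ hj
          by_cases hjA : j ∈ A
          · simp [(hh j hjA).2, hj]
          · simp [hout j hjA, CharTwo.add_self_eq_zero]
        · simp
      have key : ∑ g, χ (pb g ⬝ᵥ (x + y)) * E (x + pa g) (y + pa g) =
          χ (t * (x i + y i)) * ∑ g, χ (pb g ⬝ᵥ (x + y)) * E (x + pa g) (y + pa g) := by
        conv_lhs => rw [← Equiv.sum_comp (Equiv.addRight h)]
        rw [Finset.mul_sum]
        refine Finset.sum_congr rfl fun g _ => ?_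
        rw [Equiv.coe_addRight, map_add, map_add, add_dotProduct, AddChar.map_add_eq_mul, hdot,
          hE.2 (x + (pa g + pa h)) (y + (pa g + pa h)) (x + pa g) (y + pa g)]
        · ring
        · intro j hj
          simp [hout j hj]
        · intro j hj
          simp [hout j hj]
        · intro j hj
          simp [(hh j hj).1]
        · intro j hj
          simp [(hh j hj).1]
      have : (1 - χ (t * (x i + y i))) *
          ∑ g, χ (pb g ⬝ᵥ (x + y)) * E (x + pa g) (y + pa g) = 0 := by
        linear_combination key
      exact (mul_eq_zero.1 this).resolve_left (sub_ne_zero.2 ht.symm)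

/-- The scalars by which the group acts on `Q` have modulus 1, so each twirled matrix element equals
the original one; their sum is both |G| ⟨u, E v⟩ and c ⟨u, v⟩. -/
theorem detects_of_weyl_scalar {χ : AddChar α ℂ} (hχ : χ.IsPrimitive) (pa pb : G →+ (ι → α))
    {A : Finset ι} (hA : ∀ a b : ι → α, ∃ g, ∀ i ∈ A, pa g i = a i ∧ pb g i = b i)
    {E : Matrix (ι → α) (ι → α) ℂ} (hE : ActsOnlyOn A E)
    {Q : Submodule ℂ (EuclideanSpace ℂ (ι → α))}
    (hQ : ∀ g, ∃ μ : ℂ, ∀ v ∈ Q, weyl χ (pa g) (pb g) v = μ • v) : Detects Q E := by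
  choose μ hμ using hQ
  obtain ⟨c, hc⟩ := exists_twirl_eq hχ pa pb hA hE
  have hself : ∀ g (u v : EuclideanSpace ℂ (ι → α)),
      inner ℂ (weyl χ (pa g) (pb g) u) (weyl χ (pa g) (pb g) v) = inner ℂ u v := fun g u v => by
    have h₁ := inner_weyl_weyl χ (pa g) (pb g) 1 u v
    have h₂ := inner_toEuclideanLin 1 u v
    simp only [Matrix.toLpLin_one, LinearMap.id_apply] at h₁ h₂
    rw [h₁, h₂]
    refine Finset.sum_congr rfl fun x _ => Finset.sum_congr rfl fun y _ => ?_
    by_cases hxy : x = y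
    · subst hxy
      rw [pi_add_self_char_two, Matrix.one_apply_eq, Matrix.one_apply_eq]
      simp
    · simp [Matrix.one_apply_ne hxy, hxy]
  have hcard : (Fintype.card G : ℂ) ≠ 0 := Nat.cast_ne_zero.2 Fintype.card_ne_zero
  refine ⟨c / Fintype.card G, fun u hu v hv => ?_⟩
  by_cases hu0 : u = 0
  · simp [hu0]
  have hunit : ∀ g, star (μ g) * μ g = 1 := fun g => by
    have := hself g u u
    rw [hμ g u hu, inner_smul_left, inner_smul_right, ← mul_assoc] at this
    exact mul_right_cancel₀ (inner_self_ne_zero.2 hu0) (by rw [one_mul]; exact this)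
  have key : ∑ g, inner ℂ (weyl χ (pa g) (pb g) u)
      (Matrix.toEuclideanLin E (weyl χ (pa g) (pb g) v)) = c * inner ℂ u v := by
    simp only [inner_weyl_weyl]
    rw [Finset.sum_comm]
    have h₂ := inner_toEuclideanLin 1 u v
    simp only [Matrix.toLpLin_one, LinearMap.id_apply] at h₂
    rw [h₂, Finset.mul_sum]
    refine Finset.sum_congr rfl fun x _ => ?_
    rw [Finset.sum_comm, Finset.mul_sum]
    refine Finset.sum_congr rfl fun y _ => ?_
    rw [← Finset.mul_sum, ← Finset.sum_mul, hc]
    by_cases hxy : x = y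
    · subst hxy
      simp only [if_true, Matrix.one_apply_eq]
      ring
    · simp [hxy]
  have hterm : ∀ g, inner ℂ (weyl χ (pa g) (pb g) u)
      (Matrix.toEuclideanLin E (weyl χ (pa g) (pb g) v)) =
      inner ℂ u (Matrix.toEuclideanLin E v) := fun g => by
    rw [hμ g u hu, hμ g v hv, map_smul, inner_smul_left, inner_smul_right, ← mul_assoc]
    exact (congrArg (· * _) (hunit g)).trans (one_mul _)
  simp only [hterm, Finset.sum_const, Finset.card_univ, nsmul_eq_mul] at key
  rw [div_mul_eq_mul_div, eq_div_iff hcard, mul_comm, key]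

/-- An isotropic group of Weyl operators that restricts onto all Weyl operators on every set of
fewer than `d` sites stabilizes a quantum code that detects all errors on fewer than `d` sites. -/
theorem exists_stabilizer_code [Module (ZMod 2) G] {χ : AddChar α ℂ} (hχ : χ.IsPrimitive)
    (pa pb : G →+ (ι → α)) (hiso : ∀ g h, pb g ⬝ᵥ pa h = pb h ⬝ᵥ pa g) {d : ℕ}
    (hsurj : ∀ A : Finset ι, A.card < d → ∀ a b : ι → α, ∃ g, ∀ i ∈ A,
      pa g i = a i ∧ pb g i = b i) :
    ∃ Q : Submodule ℂ (EuclideanSpace ℂ (ι → α)),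
      Fintype.card α ^ Fintype.card ι ≤ Fintype.card G * Module.finrank ℂ Q ∧
      DetectsBelow Q d := by
  -- Weyl operators square to ±1, so the eigenspace bound applies to a basis over the field with two
  -- elements, and 2 to the dimension is |G|. The eigenvalues are left arbitrary, so no choice of
  -- signs is needed.
  let B := Module.finBasis (ZMod 2) G
  obtain ⟨Q, -, hscal, hdim⟩ := exists_common_eigenspace
    (fun i => weyl χ (pa (B i)) (pb (B i)))
    (fun i j v => by
      rw [weyl_weyl, weyl_weyl, hiso, add_comm (pa (B i)), add_comm (pb (B i))])
    (fun i => ⟨χ (pb (B i) ⬝ᵥ pa (B i)), fun h0 => by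
      simpa [h0] using addChar_mul_self_char_two χ (pb (B i) ⬝ᵥ pa (B i)), fun v => by
      rw [weyl_weyl]
      congr 1
      ext x
      simp [pi_add_self_char_two]⟩) Finset.univ
  refine ⟨Q, ?_, fun A E hA hE => detects_of_weyl_scalar hχ pa pb (hsurj A hA) hE fun g => ?_⟩
  · rw [Module.card_eq_pow_finrank (K := ZMod 2) (V := G), ZMod.card]
    simpa using hdim
  · induction B.mem_span g using Submodule.span_induction with
    | mem g hg =>
      obtain ⟨i, rfl⟩ := hg
      exact hscal i (Finset.mem_univ i)
    | zero =>
      refine ⟨1, fun v _ => ?_⟩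
      ext x
      simp
    | add g h _ _ hg hh =>
      obtain ⟨μ, hμ⟩ := hg
      obtain ⟨ν, hν⟩ := hh
      refine ⟨χ (pb h ⬝ᵥ pa g) * (μ * ν), fun v hv => ?_⟩
      have := weyl_weyl χ (pa g) (pb g) (pa h) (pb h) v
      rw [hν v hv, map_smul, hμ v hv] at this
      rw [mul_smul, mul_comm μ, mul_smul, this, smul_smul, addChar_mul_self_char_two, one_smul,
        map_add, map_add]
    | smul z g _ hg =>
      obtain ⟨μ, hμ⟩ := hg
      obtain rfl | rfl : z = 0 ∨ z = 1 := by
        revert z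
        decide
      · refine ⟨1, fun v _ => ?_⟩
        ext x
        simp
      · exact ⟨μ, fun v hv => by rw [one_smul, hμ v hv]⟩

end StabilizerCode

/-! ### The trace code -/

section TraceCode

/-- X^q − X has at most q roots in `K`, and the image of `F` already supplies q of them. -/
theorem finite_field_eq_algebraMap_of_pow_card_eq {F K : Type} [Field F] [Field K] [Algebra F K]
    [Fintype F] {x : K} (hx : x ^ Fintype.card F = x) : ∃ c : F, algebraMap F K c = x := by
  classical
  have h1 : 1 < Fintype.card F := Fintype.one_lt_card
  let p : K[X] := X ^ Fintype.card F - X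
  have hp : p ≠ 0 := FiniteField.X_pow_card_sub_X_ne_zero K h1
  have hsub : Finset.univ.image (algebraMap F K) ⊆ p.roots.toFinset := by
    intro y hy
    obtain ⟨c, -, rfl⟩ := Finset.mem_image.1 hy
    simp [p, hp, ← map_pow, FiniteField.pow_card]
  have hcard : p.roots.toFinset.card ≤ (Finset.univ.image (algebraMap F K)).card := by
    rw [Finset.card_image_of_injective _ (algebraMap F K).injective, Finset.card_univ,
      ← FiniteField.X_pow_card_sub_X_natDegree_eq K h1]
    exact (Multiset.toFinset_card_le _).trans (card_roots' _)
  have hx' : x ∈ p.roots.toFinset := by simp [p, hp, hx]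
  rw [← Finset.eq_of_subset_of_card_le hsub hcard] at hx'
  obtain ⟨c, -, hc⟩ := Finset.mem_image.1 hx'
  exact ⟨c, hc⟩

/-! ### Roots of unity and power sums over the evaluation points. -/

section PowerSums

variable {K : Type} [Field K] [Fintype K] [DecidableEq K]

theorem exists_isPrimitiveRoot_585 (hK : Fintype.card K = 64 ^ 2) :
    ∃ ζ : K, IsPrimitiveRoot ζ 585 := by
  obtain ⟨g, hg⟩ := IsCyclic.exists_ofOrder_eq_natCard (α := Kˣ)
  -- 64² − 1 = 4095 = 7 · 585, so the seventh power of a generator has order 585.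
  have hcard : Nat.card Kˣ = 7 * 585 := by
    rw [Nat.card_units, Nat.card_eq_fintype_card, hK]
    norm_num
  have h := (IsPrimitiveRoot.orderOf g).pow (orderOf_pos g) (hg.trans hcard)
  exact ⟨_, h.map_of_injective (f := Units.coeHom K) Units.val_injective⟩

theorem card_evalPoint (hK : Fintype.card K = 64 ^ 2) : Fintype.card (EvalPoint 585 K) = 586 := by
  obtain ⟨ζ, hζ⟩ := exists_isPrimitiveRoot_585 hK
  have h0 : (0 : K) ∉ nthRootsFinset 585 (1 : K) := by
    rw [mem_nthRootsFinset (by norm_num)]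
    norm_num
  rw [Fintype.card_of_subtype (insert 0 (nthRootsFinset 585 (1 : K))) fun x => by
    rw [Finset.mem_insert, mem_nthRootsFinset (by norm_num)], Finset.card_insert_of_notMem h0,
    hζ.card_nthRootsFinset]

theorem charP_two_of_card (hK : Fintype.card K = 64 ^ 2) : CharP K 2 := by
  have := Fact.mk Nat.prime_two
  exact charP_of_card_eq_prime_pow (f := 12) (by rw [hK]; norm_num)

/-- For exponent 0 the sum is 586, which is even. Otherwise multiplication by a primitive root ζ
permutes the points and multiplies the sum by ζ^e ≠ 1. -/
theorem sum_evalPoint_pow_eq_zero (hK : Fintype.card K = 64 ^ 2) {e : ℕ}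
    (he : e = 0 ∨ ¬ 585 ∣ e) : ∑ β : EvalPoint 585 K, (β : K) ^ e = 0 := by
  have := charP_two_of_card hK
  rcases he with rfl | he
  · simp only [pow_zero, Finset.sum_const, Finset.card_univ, card_evalPoint hK, nsmul_eq_mul,
      mul_one]
    exact (CharP.cast_eq_zero_iff K 2 586).2 (by norm_num)
  · obtain ⟨ζ, hζ⟩ := exists_isPrimitiveRoot_585 hK
    have hζ0 : ζ ≠ 0 := hζ.ne_zero (by norm_num)
    let σ : EvalPoint 585 K ≃ EvalPoint 585 K :=
      (Equiv.mulLeft₀ ζ hζ0).subtypeEquiv fun β => by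
        simp [mul_pow, hζ.pow_eq_one, hζ0]
    have key : ∑ β : EvalPoint 585 K, (β : K) ^ e =
        ζ ^ e * ∑ β : EvalPoint 585 K, (β : K) ^ e := by
      conv_lhs => rw [← Equiv.sum_comp σ]
      rw [Finset.mul_sum]
      refine Finset.sum_congr rfl fun β _ => ?_
      rw [← mul_pow]
      rfl
    have h1 : 1 - ζ ^ e ≠ 0 := sub_ne_zero.2 fun h => he ((hζ.pow_eq_one_iff_dvd e).1 h.symm)
    exact (mul_eq_zero.1 (by linear_combination key : (1 - ζ ^ e) * _ = 0)).resolve_left h1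

/-- Each of the 585 roots of unity contributes 1 and the point 0 contributes nothing; 585 is odd. -/
theorem sum_evalPoint_pow_of_dvd (hK : Fintype.card K = 64 ^ 2) {e : ℕ} (he : e ≠ 0)
    (hdvd : 585 ∣ e) : ∑ β : EvalPoint 585 K, (β : K) ^ e = 1 := by
  have := charP_two_of_card hK
  have hsplit : ∀ β : EvalPoint 585 K, (β : K) ^ e =
      (β : K) ^ 0 - if β = ⟨0, Or.inl rfl⟩ then 1 else 0 := by
    rintro ⟨β, rfl | hβ⟩
    · simp [he]
    · obtain ⟨k, rfl⟩ := hdvd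
      have hβ0 : β ≠ 0 := by
        rintro rfl
        norm_num at hβ
      simp [pow_mul, hβ, hβ0]
  rw [Finset.sum_congr rfl fun β _ => hsplit β, Finset.sum_sub_distrib,
    sum_evalPoint_pow_eq_zero hK (Or.inl rfl), Finset.sum_ite_eq', if_pos (Finset.mem_univ _),
    zero_sub, CharTwo.neg_eq]

end PowerSums

/-! ### Trace words: dimension, self-orthogonality and interpolation. -/

variable (F K : Type) [Field F] [Field K] [Algebra F K]

/-- The words `(c + ∑_j Tr(γ_j β^(8(j+1))))_β`. -/
noncomputable def traceWord (m : ℕ) : (F × (Fin m → K)) →ₗ[F] (EvalPoint 585 K → F) :=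
  LinearMap.pi fun β => LinearMap.fst F F (Fin m → K) + ∑ j : Fin m,
    Algebra.trace F K ∘ₗ LinearMap.mulRight F ((β : K) ^ (8 * (j + 1 : ℕ))) ∘ₗ
      LinearMap.proj j ∘ₗ LinearMap.snd F F (Fin m → K)

variable {F K}

theorem traceWord_apply (m : ℕ) (p : F × (Fin m → K)) (β : EvalPoint 585 K) :
    traceWord F K m p β =
      p.1 + ∑ j : Fin m, Algebra.trace F K (p.2 j * (β : K) ^ (8 * (j + 1 : ℕ))) := by
  simp [traceWord]

/-- The exponents of the polynomials that define the trace code. -/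
def traceExp {m : ℕ} : Option (Fin m × Bool) → ℕ
  | none => 0
  | some (j, false) => 8 * (j + 1)
  | some (j, true) => 512 * (j + 1)

theorem not_dvd_traceExp_sub (j : ℕ) (hj : j < 13) (k : ℕ) (hk : k < 13) :
    ¬ 585 ∣ 8 * (k + 1) + (585 * 12 - 512 * (j + 1)) := by
  decide +revert

/-- Modulo 585 the inverse of 8 is 512. With indices counted from 1, each exponent is therefore a
power of 8 times j + 8k or 8j + k, and these lie between 9 and 117. -/
theorem not_dvd_traceExp_add (j : ℕ) (hj : j < 13) (k : ℕ) (hk : k < 13) :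
    ¬ 585 ∣ 8 * (j + 1) + 8 * (8 * (k + 1)) ∧ ¬ 585 ∣ 8 * (j + 1) + 8 * (512 * (k + 1)) ∧
      ¬ 585 ∣ 512 * (j + 1) + 8 * (8 * (k + 1)) ∧
      ¬ 585 ∣ 512 * (j + 1) + 8 * (512 * (k + 1)) := by
  decide +revert

/-- The coefficients of the polynomials that define the trace code. -/
def traceCoeff {m : ℕ} (p : F × (Fin m → K)) : Option (Fin m × Bool) → K
  | none => algebraMap F K p.1
  | some (j, false) => p.2 j
  | some (j, true) => p.2 j ^ 64

variable [Fintype F] [Fintype K]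

theorem finrank_eq_two (hF : Fintype.card F = 64) (hK : Fintype.card K = 64 ^ 2) :
    Module.finrank F K = 2 := by
  have h := Module.card_eq_pow_finrank (K := F) (V := K)
  rw [hF, hK] at h
  exact (Nat.pow_right_injective (by norm_num : 2 ≤ 64) h).symm

theorem algebraMap_trace_eq_add (hF : Fintype.card F = 64) (hK : Fintype.card K = 64 ^ 2) (x : K) :
    algebraMap F K (Algebra.trace F K x) = x + x ^ 64 := by
  rw [FiniteField.algebraMap_trace_eq_sum_pow, finrank_eq_two hF hK, Nat.card_eq_fintype_card, hF]
  simp [Finset.sum_range_succ]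

theorem trace_pow_card (hF : Fintype.card F = 64) (hK : Fintype.card K = 64 ^ 2) (x : K) :
    Algebra.trace F K (x ^ 64) = Algebra.trace F K x := by
  apply (algebraMap F K).injective
  rw [algebraMap_trace_eq_add hF hK, algebraMap_trace_eq_add hF hK, ← pow_mul,
    show 64 * 64 = Fintype.card K by rw [hK]; norm_num, FiniteField.pow_card, add_comm]

theorem algebraMap_traceWord (hF : Fintype.card F = 64) (hK : Fintype.card K = 64 ^ 2) (m : ℕ)
    (p : F × (Fin m → K)) (β : EvalPoint 585 K) :
    algebraMap F K (traceWord F K m p β) = ∑ e, traceCoeff p e * (β : K) ^ traceExp e := by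
  rw [traceWord_apply, map_add, map_sum, Fintype.sum_option, Fintype.sum_prod_type]
  congr 1
  · simp [traceCoeff, traceExp]
  · refine Finset.sum_congr rfl fun j _ => ?_
    rw [algebraMap_trace_eq_add hF hK, Fintype.sum_bool, add_comm, mul_pow, ← pow_mul]
    simp only [traceCoeff, traceExp]
    congr 3
    ring

/-- Fourier inversion: the exponents are distinct modulo 585, so pairing a word with the
complementary power of β isolates one coefficient. -/
theorem traceWord_injective (hF : Fintype.card F = 64) (hK : Fintype.card K = 64 ^ 2) {m : ℕ}
    (hm : m ≤ 13) : Function.Injective (traceWord F K m) := by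
  classical
  rw [injective_iff_map_eq_zero]
  intro p hp
  have hcoeff : ∀ e, traceCoeff p e = 0 := fun e => by
    -- The multiple 585 · 12 = 7020 of 585 exceeds the largest exponent 512 · 13 = 6656, so the
    -- complementary exponents are positive.
    have hpos : traceExp e < 585 * 12 := by
      rcases e with - | ⟨j, - | -⟩ <;> simp only [traceExp] <;> omega
    have h0 : ∑ β : EvalPoint 585 K, algebraMap F K (traceWord F K m p β) *
        (β : K) ^ (585 * 12 - traceExp e) = 0 := by simp [hp]
    simp only [algebraMap_traceWord hF hK, Finset.sum_mul] at h0
    rw [Finset.sum_comm, Finset.sum_eq_single e] at h0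
    · simp only [mul_assoc, ← pow_add, ← Finset.mul_sum] at h0
      rwa [sum_evalPoint_pow_of_dvd hK (by omega) (by omega), mul_one] at h0
    · intro f _ hfe
      simp only [mul_assoc, ← pow_add, ← Finset.mul_sum]
      rw [sum_evalPoint_pow_eq_zero hK (Or.inr ?_), mul_zero]
      rcases e with - | ⟨j, - | -⟩ <;> rcases f with - | ⟨k, - | -⟩ <;>
        simp only [traceExp, ne_eq, not_true_eq_false, Option.some.injEq, Prod.mk.injEq, and_true,
          Fin.ext_iff] at hfe ⊢ <;>
        first
          | omega
          | exact not_dvd_traceExp_sub j (by omega) k (by omega)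
    · simp
  refine Prod.ext ?_ (funext fun j => hcoeff (some (j, false)))
  exact (algebraMap F K).injective ((hcoeff none).trans (map_zero _).symm)

theorem finrank_range_traceWord (hF : Fintype.card F = 64) (hK : Fintype.card K = 64 ^ 2) {m : ℕ}
    (hm : m ≤ 13) : Module.finrank F (LinearMap.range (traceWord F K m)) = 1 + 2 * m := by
  rw [LinearMap.finrank_range_of_inj (traceWord_injective hF hK hm), Module.finrank_prod,
    Module.finrank_self, Module.finrank_pi_fintype]
  simp [finrank_eq_two hF hK, mul_comm]

/-- The trace code is orthogonal to itself with respect to the Hermitian form. -/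
theorem sum_traceWord_mul_pow [DecidableEq K] (hF : Fintype.card F = 64)
    (hK : Fintype.card K = 64 ^ 2) {m : ℕ} (hm : m ≤ 13) (p p' : F × (Fin m → K)) :
    ∑ β, traceWord F K m p β * traceWord F K m p' β ^ 8 = 0 := by
  have := charP_two_of_card hK
  have := Fact.mk Nat.prime_two
  apply (algebraMap F K).injective
  rw [map_sum, map_zero]
  simp only [map_mul, map_pow, algebraMap_traceWord hF hK]
  have hpow : ∀ f : Option (Fin m × Bool) → K, (∑ e, f e) ^ 8 = ∑ e, f e ^ 8 := fun f =>
    sum_pow_char_pow 2 3 Finset.univ f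
  simp only [hpow, Finset.sum_mul_sum]
  rw [Finset.sum_comm]
  refine Finset.sum_eq_zero fun e _ => ?_
  rw [Finset.sum_comm]
  refine Finset.sum_eq_zero fun f _ => ?_
  have hterm : ∀ β : EvalPoint 585 K, traceCoeff p e * (β : K) ^ traceExp e *
      (traceCoeff p' f * (β : K) ^ traceExp f) ^ 8 =
      traceCoeff p e * traceCoeff p' f ^ 8 * (β : K) ^ (traceExp e + 8 * traceExp f) := fun β => by
    ring
  simp only [hterm, ← Finset.mul_sum]
  rw [sum_evalPoint_pow_eq_zero hK, mul_zero]
  rcases e with - | ⟨j, - | -⟩ <;> rcases f with - | ⟨k, - | -⟩ <;>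
    simp only [traceExp]
  · exact Or.inl trivial
  all_goals right
  · omega
  · omega
  · omega
  · exact (not_dvd_traceExp_add j (by omega) k (by omega)).1
  · exact (not_dvd_traceExp_add j (by omega) k (by omega)).2.1
  · omega
  · exact (not_dvd_traceExp_add j (by omega) k (by omega)).2.2.1
  · exact (not_dvd_traceExp_add j (by omega) k (by omega)).2.2.2

/-- The trace code restricts onto all words on any `m + 1` of the evaluation points. -/
theorem exists_traceWord_eq (hK : Fintype.card K = 64 ^ 2) {m : ℕ}
    {A : Finset (EvalPoint 585 K)} (hA : A.card ≤ m + 1) (w : EvalPoint 585 K → F) :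
    ∃ p, ∀ β ∈ A, traceWord F K m p β = w β := by
  classical
  have := charP_two_of_card hK
  have := Fact.mk Nat.prime_two
  let res : (EvalPoint 585 K → F) →ₗ[F] (A → F) := LinearMap.funLeft F F (fun β : A => (β : _))
  suffices htop : LinearMap.range (res ∘ₗ traceWord F K m) = ⊤ by
    obtain ⟨p, hp⟩ := LinearMap.range_eq_top.1 htop fun β => w β
    exact ⟨p, fun β hβ => congrFun hp ⟨β, hβ⟩⟩
  by_contra hne
  -- If the restriction is not onto, a nonzero functional, given by weights `h`, kills the
  -- restricted code. The rest shows that all its weights vanish.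
  obtain ⟨φ, hφ, hker⟩ := Submodule.exists_le_ker_of_lt_top _ (lt_top_iff_ne_top.2 hne)
  let h : A → F := fun β => φ (Pi.single β 1)
  have hφh : ∀ w, φ w = ∑ β, w β * h β := fun w => by
    conv_lhs => rw [← Finset.univ_sum_single w, map_sum]
    refine Finset.sum_congr rfl fun β _ => ?_
    rw [← smul_eq_mul, ← map_smul, ← Pi.single_smul, smul_eq_mul, mul_one]
  have hzero : ∀ p, ∑ β : A, traceWord F K m p β * h β = 0 := fun p => by
    rw [← hφh fun β : A => traceWord F K m p β]
    exact hker ⟨p, rfl⟩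
  have hpow : ∀ k ≤ m,
      ∑ β : A, algebraMap F K (h β) * ((β : EvalPoint 585 K) : K) ^ (8 * k) = 0 := by
    rintro (- | k) hk
    · have := hzero (1, 0)
      simp only [traceWord_apply, Pi.zero_apply, zero_mul, map_zero, Finset.sum_const_zero,
        add_zero, one_mul] at this
      simp only [mul_zero, pow_zero, mul_one]
      rw [← map_sum, this, map_zero]
    -- The trace of γ times the sum vanishes for all γ, so nondegeneracy of the trace form gives
    -- vanishing of the sum itself in `K`.
    · refine (traceForm_nondegenerate F K).2 _ fun γ => ?_
      have := hzero (0, Pi.single ⟨k, hk⟩ γ)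
      simp only [traceWord_apply, zero_add] at this
      rw [Algebra.traceForm_apply, Finset.mul_sum, map_sum, ← this]
      refine Finset.sum_congr rfl fun β _ => ?_
      rw [Finset.sum_eq_single ⟨k, hk⟩]
      · rw [Pi.single_eq_same, mul_left_comm, ← Algebra.smul_def, map_smul, smul_eq_mul, mul_comm]
      · intro j _ hj
        rw [Pi.single_eq_of_ne hj, zero_mul, map_zero]
      · simp
  have hpoly : ∀ P : K[X], P.natDegree < m + 1 →
      ∑ β : A, algebraMap F K (h β) * P.eval (((β : EvalPoint 585 K) : K) ^ 8) = 0 := fun P hP => by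
    simp only [eval_eq_sum_range' hP, Finset.mul_sum]
    rw [Finset.sum_comm]
    refine Finset.sum_eq_zero fun k hk => ?_
    have := congrArg (P.coeff k * ·) (hpow k (Nat.lt_succ_iff.1 (Finset.mem_range.1 hk)))
    simp only [mul_zero, Finset.mul_sum] at this
    refine Eq.trans ?_ this
    refine Finset.sum_congr rfl fun β _ => ?_
    rw [pow_mul]
    ring
  apply hφ
  ext β₀
  suffices hβ₀ : h β₀ = 0 by simpa [h] using hβ₀
  -- This polynomial in β^8 vanishes at all points of `A` except `β₀` and has degree at most m. It
  -- is nonzero at `β₀` because the eighth power, an iterate of Frobenius, is injective.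
  let P : K[X] := ∏ β ∈ Finset.univ.erase β₀, (X - C (((β : EvalPoint 585 K) : K) ^ 8))
  have hP : P.natDegree < m + 1 := by
    have h1 : 0 < A.card := Finset.card_pos.2 ⟨_, β₀.2⟩
    have h2 : P.natDegree = A.card - 1 := by
      rw [natDegree_prod_of_monic _ _ fun β _ => monic_X_sub_C _]
      simp only [natDegree_X_sub_C]
      simp
    omega
  have hsum := hpoly P hP
  have heval : ∀ x, P.eval x = ∏ β ∈ Finset.univ.erase β₀, (x - ((β : EvalPoint 585 K) : K) ^ 8) :=
    fun x => by simp [P, eval_prod]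
  rw [Finset.sum_eq_single β₀] at hsum
  · rcases mul_eq_zero.1 hsum with h0 | h0
    · exact (algebraMap F K).injective (h0.trans (map_zero _).symm)
    · rw [heval, Finset.prod_eq_zero_iff] at h0
      obtain ⟨β, hβ, h8⟩ := h0
      have := iterateFrobenius_inj K 2 3 (sub_eq_zero.1 h8)
      exact absurd (Subtype.ext (Subtype.ext this)).symm (Finset.ne_of_mem_erase hβ)
  · intro β _ hβ
    rw [heval, Finset.prod_eq_zero (Finset.mem_erase.2 ⟨hβ, Finset.mem_univ β⟩) (sub_self _),
      mul_zero]
  · simp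

end TraceCode

/-! ### Cosets -/

section Cosets

theorem sq_64_eq_one : (64 : ZMod 585) * 64 = 1 := by decide

theorem cyclotomicCoset_eq_pair (a : ZMod 585) : cyclotomicCoset 64 585 a = {a, 64 * a} := by
  ext b
  simp only [cyclotomicCoset, Set.mem_range, Set.mem_insert_iff, Set.mem_singleton_iff]
  constructor
  · rintro ⟨i, rfl⟩
    rcases Nat.even_or_odd' i with ⟨k, rfl | rfl⟩
    · left
      rw [pow_mul, Nat.cast_ofNat, sq, sq_64_eq_one, one_pow, mul_one]
    · right
      rw [pow_succ, pow_mul, Nat.cast_ofNat, sq, sq_64_eq_one, one_pow, one_mul, mul_comm]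
  · rintro (rfl | rfl)
    · exact ⟨0, by simp⟩
    · exact ⟨1, by simp [mul_comm]⟩

theorem cyclotomicCoset_eq_iff {a b : ZMod 585} :
    cyclotomicCoset 64 585 a = cyclotomicCoset 64 585 b ↔ a = b ∨ a = 64 * b := by
  rw [cyclotomicCoset_eq_pair, cyclotomicCoset_eq_pair]
  constructor
  · intro h
    have : a ∈ ({b, 64 * b} : Set (ZMod 585)) := h ▸ Set.mem_insert a _
    simpa using this
  · rintro (rfl | rfl)
    · rfl
    · rw [← mul_assoc, sq_64_eq_one, one_mul, Set.pair_comm]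

theorem cyclotomicCoset_zero : cyclotomicCoset 64 585 0 = {0} := by
  simp [cyclotomicCoset_eq_pair]

/-- The set of the cosets `S_(8j)` with `j ≤ m`. -/
def traceCosets (m : ℕ) : Set (Set (ZMod 585)) :=
  {B | ∃ j : ℕ, j ≤ m ∧ B = cyclotomicCoset 64 585 (8 * (j : ZMod 585))}

/-- 8 · 8 = 64 acts trivially on cosets, so scaling by 8 turns S_{8j} into S_j. -/
theorem scaleCosets_traceCosets (m : ℕ) : scaleCosets 64 585 8 (traceCosets m) =
    {B | ∃ j : ℕ, j ≤ m ∧ B = cyclotomicCoset 64 585 (j : ZMod 585)} := by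
  ext B
  constructor
  · rintro ⟨a, ⟨j, hj, ha⟩, rfl⟩
    refine ⟨j, hj, cyclotomicCoset_eq_iff.2 ?_⟩
    rcases cyclotomicCoset_eq_iff.1 ha with rfl | rfl
    · right
      push_cast
      ring
    · left
      push_cast
      linear_combination (j : ZMod 585) * sq_64_eq_one
  · rintro ⟨j, hj, rfl⟩
    refine ⟨8 * j, ⟨j, hj, rfl⟩, cyclotomicCoset_eq_iff.2 (Or.inr ?_)⟩
    push_cast
    linear_combination -(j : ZMod 585) * sq_64_eq_one

theorem dualCosets_scaleCosets_traceCosets (m : ℕ) :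
    dualCosets 64 585 (scaleCosets 64 585 8 (traceCosets m)) =
      {B | ∃ j : ℕ, j ≤ m ∧ B = cyclotomicCoset 64 585 (-(j : ZMod 585))} := by
  rw [scaleCosets_traceCosets]
  ext B
  constructor
  · rintro ⟨⟨c, rfl⟩, A, ⟨j, hj, rfl⟩, a, ha, b, hb, hab⟩
    refine ⟨j, hj, cyclotomicCoset_eq_iff.2 ?_⟩
    rw [cyclotomicCoset_eq_pair, Set.mem_insert_iff, Set.mem_singleton_iff] at ha hb
    rcases ha with rfl | rfl <;> rcases hb with rfl | rfl
    · left
      linear_combination hab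
    · right
      linear_combination 64 * hab - c * sq_64_eq_one
    · right
      linear_combination hab
    · left
      linear_combination 64 * hab - (c + j) * sq_64_eq_one
  · rintro ⟨j, hj, rfl⟩
    refine ⟨⟨_, rfl⟩, _, ⟨j, hj, rfl⟩, j, ⟨0, by simp⟩, -j, ⟨0, by simp⟩, add_neg_cancel _⟩

theorem natCast_ne_zero_of_lt {a : ℕ} (h0 : 0 < a) (h : a < 585) : (a : ZMod 585) ≠ 0 := by
  rw [Ne, ZMod.natCast_eq_zero_iff]
  omega

/-- The residues from 585 − m to 584 are the −j with 1 ≤ j ≤ m, which gives the distance m + 2. If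
S_{8i} equalled S_{−j}, then 8i + j or i + 8j would vanish modulo 585; for i > 0 both lie between 1
and 117. -/
theorem isAdmissible_traceCosets {m : ℕ} (hm : m ≤ 13) :
    IsAdmissible 64 585 8 (m + 2) (traceCosets m) := by
  refine ⟨?_, ⟨0, by omega, by simp [cyclotomicCoset_zero]⟩, fun a ha ha' => ?_, ?_⟩
  · rintro _ ⟨j, -, rfl⟩
    exact ⟨_, rfl⟩
  · rw [dualCosets_scaleCosets_traceCosets]
    refine ⟨585 - a, by omega, ?_⟩
    rw [Nat.cast_sub (by omega), show ((585 : ℕ) : ZMod 585) = 0 from ZMod.natCast_self 585]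
    simp
  · rintro _ ⟨i, hi, rfl⟩
    rcases Nat.eq_zero_or_pos i with rfl | hi0
    · left
      simp [cyclotomicCoset_zero]
    · right
      refine ⟨⟨_, rfl⟩, ?_⟩
      rw [dualCosets_scaleCosets_traceCosets]
      rintro ⟨j, hj, hij⟩
      rcases cyclotomicCoset_eq_iff.1 hij with h | h
      · refine natCast_ne_zero_of_lt (a := 8 * i + j) (by omega) (by omega) ?_
        push_cast
        linear_combination h
      · refine natCast_ne_zero_of_lt (a := i + 8 * j) (by omega) (by omega) ?_
        push_cast
        have h73 : (8 : ZMod 585) * 512 = 1 := by decide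
        linear_combination 512 * h - (i + 8 * j) * h73

/-! ### The explicit cosets for m = 2. -/

theorem traceCosets_two : traceCosets 2 = {{0}, {8, 512}, {16, 439}} := by
  ext B
  simp only [traceCosets, Set.mem_ofPred_eq, Set.mem_insert_iff, Set.mem_singleton_iff,
    cyclotomicCoset_eq_pair]
  have h0 : ({8 * ((0 : ℕ) : ZMod 585), 64 * (8 * ((0 : ℕ) : ZMod 585))} : Set (ZMod 585)) =
      {0} := by
    simp
  have h1 : ({8 * ((1 : ℕ) : ZMod 585), 64 * (8 * ((1 : ℕ) : ZMod 585))} : Set (ZMod 585)) =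
      {8, 512} := by
    congr 1
  have h2 : ({8 * ((2 : ℕ) : ZMod 585), 64 * (8 * ((2 : ℕ) : ZMod 585))} : Set (ZMod 585)) =
      {16, 439} := by
    congr 1
  constructor
  · rintro ⟨j, hj, rfl⟩
    interval_cases j
    · exact Or.inl h0
    · exact Or.inr (Or.inl h1)
    · exact Or.inr (Or.inr h2)
  · rintro (rfl | rfl | rfl)
    · exact ⟨0, by omega, h0.symm⟩
    · exact ⟨1, by omega, h1.symm⟩
    · exact ⟨2, by omega, h2.symm⟩

theorem scaleCosets_traceCosets_two :
    scaleCosets 64 585 8 (traceCosets 2) = {{0}, {1, 64}, {2, 128}} := by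
  rw [scaleCosets_traceCosets]
  ext B
  simp only [Set.mem_ofPred_eq, Set.mem_insert_iff, Set.mem_singleton_iff, cyclotomicCoset_eq_pair]
  have h0 : ({((0 : ℕ) : ZMod 585), 64 * ((0 : ℕ) : ZMod 585)} : Set (ZMod 585)) = {0} := by simp
  have h1 : ({((1 : ℕ) : ZMod 585), 64 * ((1 : ℕ) : ZMod 585)} : Set (ZMod 585)) = {1, 64} := by
    congr 1
  have h2 : ({((2 : ℕ) : ZMod 585), 64 * ((2 : ℕ) : ZMod 585)} : Set (ZMod 585)) = {2, 128} := by
    congr 1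
  constructor
  · rintro ⟨j, hj, rfl⟩
    interval_cases j
    · exact Or.inl h0
    · exact Or.inr (Or.inl h1)
    · exact Or.inr (Or.inr h2)
  · rintro (rfl | rfl | rfl)
    · exact ⟨0, by omega, h0.symm⟩
    · exact ⟨1, by omega, h1.symm⟩
    · exact ⟨2, by omega, h2.symm⟩

theorem dualCosets_scaleCosets_traceCosets_two :
    dualCosets 64 585 (scaleCosets 64 585 8 (traceCosets 2)) =
      {{0}, {457, 583}, {521, 584}} := by
  rw [dualCosets_scaleCosets_traceCosets]
  ext B
  simp only [Set.mem_ofPred_eq, Set.mem_insert_iff, Set.mem_singleton_iff, cyclotomicCoset_eq_pair]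
  have h0 : ({-((0 : ℕ) : ZMod 585), 64 * -((0 : ℕ) : ZMod 585)} : Set (ZMod 585)) = {0} := by simp
  have h1 : ({-((1 : ℕ) : ZMod 585), 64 * -((1 : ℕ) : ZMod 585)} : Set (ZMod 585)) =
      {521, 584} := by
    rw [Set.pair_comm]
    congr 1
  have h2 : ({-((2 : ℕ) : ZMod 585), 64 * -((2 : ℕ) : ZMod 585)} : Set (ZMod 585)) =
      {457, 583} := by
    rw [Set.pair_comm]
    congr 1
  constructor
  · rintro ⟨j, hj, rfl⟩
    interval_cases j
    · exact Or.inl h0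
    · exact Or.inr (Or.inr h1)
    · exact Or.inr (Or.inl h2)
  · rintro (rfl | rfl | rfl)
    · exact ⟨0, by omega, h0.symm⟩
    · exact ⟨2, by omega, h2.symm⟩
    · exact ⟨1, by omega, h1.symm⟩

theorem ncard_cyclotomicCoset {a : ZMod 585} (ha : 64 * a ≠ a) :
    (cyclotomicCoset 64 585 a).ncard = 2 := by
  rw [cyclotomicCoset_eq_pair, Set.ncard_pair ha.symm]

theorem mul_64_ne_self {j : ℕ} (hj : 0 < j) (hj' : j ≤ 13) :
    (64 : ZMod 585) * (8 * (j : ZMod 585)) ≠ 8 * (j : ZMod 585) := by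
  intro h
  have h504 : ((504 * j : ℕ) : ZMod 585) = 0 := by
    push_cast
    linear_combination h
  rw [ZMod.natCast_eq_zero_iff] at h504
  omega

/-! ### The polynomial code is the trace code -/

variable {F K : Type} [Field F] [Field K] [Algebra F K]

theorem evalPoints_apply (f : K[X]) (β : EvalPoint 585 K) :
    evalPoints 585 F K f β = f.eval (β : K) := by
  simp [evalPoints, aeval_def, eval₂_eq_eval_map]

theorem eval_cosetPoly_zero (γ : K) (x : K) : (cosetPoly 64 585 K 0 γ).eval x = γ := by
  simp [cosetPoly, cyclotomicCoset_zero]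

variable [Fintype F] [Fintype K]

theorem eval_cosetPoly (hF : Fintype.card F = 64) (hK : Fintype.card K = 64 ^ 2) {a : ZMod 585}
    (ha : 64 * a ≠ a) (γ x : K) :
    (cosetPoly 64 585 K a γ).eval x = algebraMap F K (Algebra.trace F K (γ * x ^ a.val)) := by
  simp [cosetPoly, ncard_cyclotomicCoset ha, Finset.sum_range_succ, algebraMap_trace_eq_add hF hK]

/-- Nonzero exponents are required because of the evaluation point 0, where 0^0 = 1. -/
theorem evalPoint_pow_congr (β : EvalPoint 585 K) {e f : ℕ} (he : e ≠ 0) (hf : f ≠ 0)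
    (h : (e : ZMod 585) = f) : (β : K) ^ e = (β : K) ^ f := by
  obtain ⟨β, rfl | hβ⟩ := β
  · simp [he, hf]
  · exact pow_eq_pow_of_modEq ((ZMod.natCast_eq_natCast_iff _ _ _).1 h) hβ

theorem map_polySpace_traceCosets (hF : Fintype.card F = 64) (hK : Fintype.card K = 64 ^ 2) {m : ℕ}
    (hm : m ≤ 13) : (polySpace 64 585 F K (traceCosets m)).map (evalPoints 585 F K) =
      (LinearMap.range (traceWord F K m)).map
        ((Algebra.linearMap F K).compLeft (EvalPoint 585 K)) := by
  classical
  apply le_antisymm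
  · rw [polySpace, Submodule.map_span, Submodule.span_le]
    rintro _ ⟨_, ⟨a, γ, ⟨j, hj, ha⟩, hγ, rfl⟩, rfl⟩
    rcases Nat.eq_zero_or_pos j with rfl | hj0
    · obtain rfl : a = 0 := by
        simpa using cyclotomicCoset_eq_iff.1 ha
      rw [cyclotomicCoset_zero, Set.ncard_singleton, pow_one, ← hF] at hγ
      obtain ⟨c, rfl⟩ := finite_field_eq_algebraMap_of_pow_card_eq hγ
      refine ⟨_, ⟨(c, 0), rfl⟩, ?_⟩
      ext β
      simp [evalPoints_apply, eval_cosetPoly_zero, traceWord_apply]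
    · have hne : (64 : ZMod 585) * (8 * (j : ZMod 585)) ≠ 8 * (j : ZMod 585) :=
        mul_64_ne_self hj0 (hj.trans hm)
      have hne' : 64 * a ≠ a := by
        rcases cyclotomicCoset_eq_iff.1 ha with rfl | rfl
        · exact hne
        · rw [← mul_assoc, sq_64_eq_one, one_mul]
          exact hne.symm
      have ha0 : a.val ≠ 0 := by
        rw [Ne, ZMod.val_eq_zero]
        rintro rfl
        simp at hne'
      obtain ⟨γ', hγ'⟩ : ∃ γ' : K, ∀ β : EvalPoint 585 K,
          Algebra.trace F K (γ * (β : K) ^ a.val) =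
            Algebra.trace F K (γ' * (β : K) ^ (8 * j)) := by
        rcases cyclotomicCoset_eq_iff.1 ha with h | h
        · refine ⟨γ, fun β => ?_⟩
          rw [evalPoint_pow_congr β ha0 (by omega : 8 * j ≠ 0)]
          simp [h]
        -- When `a` is the other representative 64 · 8j, Frobenius invariance of the trace moves it
        -- back to 8j at the price of replacing γ by γ^64.
        · refine ⟨γ ^ 64, fun β => ?_⟩
          rw [← trace_pow_card hF hK, mul_pow, ← pow_mul,
            evalPoint_pow_congr β (mul_ne_zero ha0 (by norm_num)) (by omega : 8 * j ≠ 0)]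
          push_cast
          rw [ZMod.natCast_zmod_val, h]
          linear_combination (8 * j : ZMod 585) * sq_64_eq_one
      obtain ⟨k, rfl⟩ : ∃ k, j = k + 1 := ⟨j - 1, by omega⟩
      refine ⟨_, ⟨(0, Pi.single ⟨k, hj⟩ γ'), rfl⟩, ?_⟩
      ext β
      rw [evalPoints_apply, eval_cosetPoly hF hK hne', hγ']
      simp only [LinearMap.compLeft_apply, Function.comp_apply, Algebra.linearMap_apply,
        traceWord_apply, zero_add]
      rw [Finset.sum_eq_single ⟨k, hj⟩]
      · simp
      · intro i _ hi
        simp [hi]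
      · simp
  · rintro _ ⟨_, ⟨p, rfl⟩, rfl⟩
    refine ⟨cosetPoly 64 585 K 0 (algebraMap F K p.1) +
      ∑ j : Fin m, cosetPoly 64 585 K (8 * ((j + 1 : ℕ) : ZMod 585)) (p.2 j), ?_, ?_⟩
    · refine Submodule.add_mem _ (Submodule.subset_span ⟨0, _, ⟨0, by omega, by simp⟩, ?_, rfl⟩)
        (Submodule.sum_mem _ fun j _ =>
          Submodule.subset_span ⟨_, _, ⟨j + 1, by omega, rfl⟩, ?_, rfl⟩)
      · rw [cyclotomicCoset_zero, Set.ncard_singleton, pow_one, ← map_pow, ← hF,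
          FiniteField.pow_card]
      · rw [ncard_cyclotomicCoset (mul_64_ne_self (by omega) (by omega)), ← hK,
          FiniteField.pow_card]
    · ext β
      rw [evalPoints_apply, eval_add, eval_cosetPoly_zero, eval_finsetSum]
      simp only [LinearMap.compLeft_apply, Function.comp_apply, Algebra.linearMap_apply,
        traceWord_apply, map_add, map_sum]
      congr 1
      refine Finset.sum_congr rfl fun j _ => ?_
      rw [eval_cosetPoly hF hK (mul_64_ne_self (by omega) (by omega))]
      congr 3
      refine congrArg _ ?_
      rw [show (8 * ((j + 1 : ℕ) : ZMod 585)) = ((8 * (j + 1) : ℕ) : ZMod 585) by push_cast; rfl,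
        ZMod.val_natCast_of_lt (by omega)]

theorem polyCode_traceCosets (hF : Fintype.card F = 64) (hK : Fintype.card K = 64 ^ 2) {m : ℕ}
    (hm : m ≤ 13) :
    polyCode 64 585 F K (traceCosets m) = LinearMap.range (traceWord F K m) := by
  rw [polyCode, map_polySpace_traceCosets hF hK hm, Submodule.comap_map_eq_of_injective]
  exact fun v w h => funext fun β => (algebraMap F K).injective (congrFun h β)

theorem finrank_polyCode_traceCosets {F K : Type} [Field F] [Field K] [Algebra F K]
    (hF : Nat.card F = 64) (hK : Nat.card K = 64 ^ 2) {m : ℕ} (hm : m ≤ 13) :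
    Module.finrank F (polyCode 64 585 F K (traceCosets m)) = 1 + 2 * m := by
  have := Nat.finite_of_card_ne_zero (by rw [hF]; norm_num : Nat.card F ≠ 0)
  have := Nat.finite_of_card_ne_zero (by rw [hK]; norm_num : Nat.card K ≠ 0)
  have := Fintype.ofFinite F
  have := Fintype.ofFinite K
  rw [Nat.card_eq_fintype_card] at hF hK
  rw [polyCode_traceCosets hF hK hm, finrank_range_traceWord hF hK hm]

end Cosets

/-! ### The quantum codes -/

section QuantumTraceCode

/-- Coordinates on a quadratic extension of the field with eight elements in which the
skew-Hermitian form becomes a multiple of the standard symplectic form. -/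
theorem exists_symplectic_coordinates {α F : Type} [Field α] [Fintype α] [Field F] [Fintype F]
    [Algebra α F] (hα : Fintype.card α = 8) (hF : Fintype.card F = 64) :
    ∃ (pa pb : F →ₗ[α] α) (δ : F), δ ≠ 0 ∧ (∀ a b, ∃ x, pa x = a ∧ pb x = b) ∧
      ∀ x y, x * y ^ 8 - y * x ^ 8 = algebraMap α F (pa x * pb y - pb x * pa y) * δ := by
  have := Fact.mk Nat.prime_two
  have : CharP F 2 := charP_of_card_eq_prime_pow (f := 6) (by rw [hF]; norm_num)
  have hpow : ∀ c : α, algebraMap α F c ^ 8 = algebraMap α F c := fun c => by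
    rw [← map_pow, ← hα, FiniteField.pow_card]
  -- Any ω outside the subfield of eight elements gives a basis 1, ω. The eighth power fixes the
  -- coordinates, and the form becomes their determinant times δ = ω^8 − ω.
  obtain ⟨ω, hω⟩ : ∃ ω : F, ω ^ 8 ≠ ω := by
    by_contra! hcon
    have hsurj : Function.Surjective (algebraMap α F) := fun x =>
      finite_field_eq_algebraMap_of_pow_card_eq (by rw [hα, hcon])
    have := Fintype.card_le_of_surjective _ hsurj
    omega
  let φ : (α × α) →ₗ[α] F :=
    LinearMap.coprod (Algebra.linearMap α F) (LinearMap.toSpanSingleton α F ω)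
  have hφ : ∀ p, φ p = algebraMap α F p.1 + algebraMap α F p.2 * ω := fun p => by
    simp [φ, Algebra.smul_def]
  have hinj : Function.Injective φ := by
    rw [injective_iff_map_eq_zero]
    rintro ⟨p, q⟩ h
    rw [hφ] at h
    simp only at h
    have hq : q = 0 := by
      by_contra hq
      have hq' : algebraMap α F q ≠ 0 := by simpa using hq
      have hω' : ω = algebraMap α F (-p / q) := by
        rw [map_div₀, map_neg, eq_div_iff hq']
        linear_combination h
      exact hω (by rw [hω', hpow])
    subst hq
    simpa using h
  have hbij : Function.Bijective φ :=
    (Fintype.bijective_iff_injective_and_card φ).2 ⟨hinj, by rw [Fintype.card_prod, hα, hF]⟩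
  let ψ := LinearEquiv.ofBijective φ hbij
  refine ⟨LinearMap.fst α α α ∘ₗ ψ.symm.toLinearMap, LinearMap.snd α α α ∘ₗ ψ.symm.toLinearMap,
    ω ^ 8 - ω, sub_ne_zero.2 hω, fun a b => ⟨ψ (a, b), by simp, by simp⟩, fun x y => ?_⟩
  obtain ⟨⟨p, q⟩, rfl⟩ := ψ.surjective x
  obtain ⟨⟨p', q'⟩, rfl⟩ := ψ.surjective y
  have hψ : ∀ p q, ψ (p, q) = algebraMap α F p + algebraMap α F q * ω := fun p q => hφ (p, q)
  have h8 : ∀ p q, ψ (p, q) ^ 8 = algebraMap α F p + algebraMap α F q * ω ^ 8 := fun p q => by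
    rw [hψ, show 8 = 2 ^ 3 from rfl, add_pow_char_pow, mul_pow]
    simp [hpow]
  simp only [LinearMap.comp_apply, LinearEquiv.coe_coe, LinearEquiv.symm_apply_apply,
    LinearMap.fst_apply, LinearMap.snd_apply, map_sub, map_mul]
  rw [h8, h8, hψ, hψ]
  ring

/-- The code obtained from the trace code by the Hermitian construction. -/
theorem exists_detectsBelow_of_traceCode {α F K ι : Type} [Field α] [Fintype α] [DecidableEq α]
    [Field F] [Fintype F] [Field K] [Fintype K] [Algebra α F] [Algebra F K] [Fintype ι]
    [DecidableEq ι] (hα : Fintype.card α = 8) (hF : Fintype.card F = 64)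
    (hK : Fintype.card K = 64 ^ 2) (e : ι ≃ EvalPoint 585 K) {m : ℕ} (hm : m ≤ 13) :
    ∃ Q : Submodule ℂ (EuclideanSpace ℂ (ι → α)),
      8 ^ Fintype.card ι ≤ 8 ^ (2 + 4 * m) * Module.finrank ℂ Q ∧ DetectsBelow Q (m + 2) := by
  classical
  have := Fact.mk Nat.prime_two
  have : CharP α 2 := charP_of_card_eq_prime_pow (f := 3) (by rw [hα]; norm_num)
  have : CharP F 2 := charP_of_card_eq_prime_pow (f := 6) (by rw [hF]; norm_num)
  have : CharP K 2 := charP_two_of_card hK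
  let _ : Algebra (ZMod 2) F := ZMod.algebra F 2
  let _ : Algebra (ZMod 2) K := ZMod.algebra K 2
  obtain ⟨pa, pb, δ, hδ, hsurj, hform⟩ := exists_symplectic_coordinates hα hF
  let word (p : F →ₗ[α] α) : (F × (Fin m → K)) →+ (ι → α) :=
    { toFun := fun g i => p (traceWord F K m g (e i))
      map_zero' := by
        ext
        simp
      map_add' := fun g h => by
        ext
        simp }
  have hword : ∀ p g i, word p g i = p (traceWord F K m g (e i)) := fun _ _ _ => rfl
  obtain ⟨Q, hdim, hQ⟩ := exists_stabilizer_code (d := m + 2)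
    (AddChar.FiniteField.primitiveChar_to_Complex_isPrimitive α) (word pa) (word pb)
    (fun g h => by
      have h₁ := sum_traceWord_mul_pow hF hK hm g h
      have h₂ := sum_traceWord_mul_pow hF hK hm h g
      -- The symplectic form of two words, times δ, is the difference of two Hermitian products,
      -- both of which are zero.
      have h₃ : algebraMap α F (∑ i, (word pa g i * word pb h i - word pb g i * word pa h i)) * δ =
          0 := by
        rw [map_sum, Finset.sum_mul]
        simp only [hword, ← hform]
        rw [Equiv.sum_comp e fun β => traceWord F K m g β * traceWord F K m h β ^ 8 -
          traceWord F K m h β * traceWord F K m g β ^ 8, Finset.sum_sub_distrib, h₁, h₂, sub_zero]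
      have h₄ := (mul_eq_zero.1 h₃).resolve_right hδ
      rw [map_eq_zero, Finset.sum_sub_distrib, sub_eq_zero] at h₄
      rw [dotProduct, dotProduct, ← h₄]
      exact Finset.sum_congr rfl fun i _ => mul_comm _ _)
    (fun A hA a b => by
      choose x hx hx' using fun β => hsurj (a (e.symm β)) (b (e.symm β))
      obtain ⟨g, hg⟩ := exists_traceWord_eq (F := F) (m := m) hK (A := A.map e.toEmbedding)
        (by rw [Finset.card_map]; omega) x
      refine ⟨g, fun i hi => ?_⟩
      have hgi := hg (e i) (Finset.mem_map_of_mem _ hi)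
      exact ⟨by rw [hword, hgi, hx, e.symm_apply_apply], by rw [hword, hgi, hx', e.symm_apply_apply]⟩)
  refine ⟨Q, ?_, hQ⟩
  have hcard : Fintype.card (F × (Fin m → K)) = 8 ^ (2 + 4 * m) := by
    rw [Fintype.card_prod, Fintype.card_pi, Finset.prod_const, hF, hK, Finset.card_univ,
      Fintype.card_fin, pow_add, pow_mul]
    norm_num
  rwa [hα, hcard] at hdim

theorem exists_field_tower : ∃ (F₁ F₂ F₃ : Type) (_ : Field F₁) (_ : Field F₂) (_ : Field F₃)
    (_ : Algebra F₁ F₂) (_ : Algebra F₂ F₃),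
    Nat.card F₁ = 8 ∧ Nat.card F₂ = 64 ∧ Nat.card F₃ = 64 ^ 2 := by
  have := Fact.mk Nat.prime_two
  obtain ⟨f⟩ := FiniteField.nonempty_algHom_of_finrank_dvd (F := ZMod 2) (K := GaloisField 2 3)
    (L := GaloisField 2 6) (by
      rw [GaloisField.finrank 2 (by norm_num), GaloisField.finrank 2 (by norm_num)]; norm_num)
  obtain ⟨g⟩ := FiniteField.nonempty_algHom_of_finrank_dvd (F := ZMod 2) (K := GaloisField 2 6)
    (L := GaloisField 2 12) (by
      rw [GaloisField.finrank 2 (by norm_num), GaloisField.finrank 2 (by norm_num)]; norm_num)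
  refine ⟨GaloisField 2 3, GaloisField 2 6, GaloisField 2 12, inferInstance, inferInstance,
    inferInstance, f.toRingHom.toAlgebra, g.toRingHom.toAlgebra, ?_, ?_, ?_⟩ <;>
  · rw [GaloisField.card 2 _ (by norm_num)]
    norm_num

theorem exists_submodule_le_finrank_eq {V : Type} [AddCommGroup V] [Module ℂ V]
    (Q : Submodule ℂ V) {n : ℕ} (hn : n ≤ Module.finrank ℂ Q) :
    ∃ Q' ≤ Q, Module.finrank ℂ Q' = n := by
  obtain ⟨f, hf⟩ := exists_linearIndependent_of_le_finrank hn
  refine ⟨Submodule.span ℂ (Set.range fun i => (f i : V)), ?_, ?_⟩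
  · rw [Submodule.span_le]
    rintro _ ⟨i, rfl⟩
    exact (f i).2
  · rw [finrank_span_eq_card (b := fun i => (f i : V)) (hf.map' Q.subtype Q.ker_subtype),
      Fintype.card_fin]

theorem existsQuantumCode_586 {m : ℕ} (hm : m ≤ 13) :
    ExistsQuantumCode 8 586 (584 - 4 * m) (m + 2) := by
  classical
  obtain ⟨F₁, F, K, _, _, _, _, _, h₁, hF, hK⟩ := exists_field_tower
  have := Nat.finite_of_card_ne_zero (by rw [h₁]; norm_num : Nat.card F₁ ≠ 0)
  have := Nat.finite_of_card_ne_zero (by rw [hF]; norm_num : Nat.card F ≠ 0)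
  have := Nat.finite_of_card_ne_zero (by rw [hK]; norm_num : Nat.card K ≠ 0)
  have := Fintype.ofFinite F
  have := Fintype.ofFinite K
  rw [Nat.card_eq_fintype_card] at hF hK
  let e : Fin 8 ≃ F₁ := (Finite.equivFinOfCardEq h₁).symm
  -- The alphabet `Fin 8` receives its field structure by transport from a field with eight
  -- elements.
  let _ : Field (Fin 8) := e.field
  let _ : Algebra (Fin 8) F := ((algebraMap F₁ F).comp e.ringEquiv.toRingHom).toAlgebra
  obtain ⟨Q, hdim, hQ⟩ := exists_detectsBelow_of_traceCode (α := Fin 8) (Fintype.card_fin 8) hF hK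
    (Fintype.equivFinOfCardEq (card_evalPoint hK)).symm hm
  have hpow : 8 ^ Fintype.card (Fin 586) = 8 ^ (2 + 4 * m) * 8 ^ (584 - 4 * m) := by
    rw [Fintype.card_fin, ← pow_add]
    congr 1
    omega
  rw [hpow] at hdim
  obtain ⟨Q', hle, hfin⟩ := exists_submodule_le_finrank_eq Q
    (Nat.le_of_mul_le_mul_left hdim (by positivity))
  obtain ⟨P, hP, hdist⟩ := exists_hasMinDistance (d := m + 2) (by omega)
    (by rw [hfin]; exact Nat.one_lt_pow (by omega) (by norm_num)) (hQ.mono_left hle)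
  exact ⟨P, hP.trans hfin, hdist⟩

end QuantumTraceCode

theorem mainTheorem6 :
    -- the order of 64 modulo 585 is 2
    orderOf (64 : ZMod 585) = 2 ∧
    -- the explicit choice of cosets
    (∃ 𝒮 : Set (Set (ZMod 585)), 𝒮 = {{0}, {8, 512}, {16, 439}} ∧
      scaleCosets 64 585 8 𝒮 = {{0}, {1, 64}, {2, 128}} ∧
      dualCosets 64 585 (scaleCosets 64 585 8 𝒮) = {{0}, {457, 583}, {521, 584}} ∧
      IsAdmissible 64 585 8 4 𝒮 ∧
      (∀ (F K : Type) [Field F] [Field K] [Algebra F K],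
        Nat.card F = 64 → Nat.card K = 64 ^ 2 →
          576 + 2 * Module.finrank F (polyCode 64 585 F K 𝒮) = 586)) ∧
    ExistsQuantumCode 8 586 576 4 ∧
    -- the similar choices, for the pairs (dimension, distance)
    (∀ p ∈ ([(572, 5), (568, 6), (564, 7), (560, 8), (556, 9), (552, 10), (548, 11), (544, 12),
        (540, 13), (536, 14), (532, 15)] : List (ℕ × ℕ)),
      (∃ 𝒮 : Set (Set (ZMod 585)), IsAdmissible 64 585 8 p.2 𝒮 ∧
        (∀ (F K : Type) [Field F] [Field K] [Algebra F K],
          Nat.card F = 64 → Nat.card K = 64 ^ 2 →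
            p.1 + 2 * Module.finrank F (polyCode 64 585 F K 𝒮) = 586)) ∧
      ExistsQuantumCode 8 586 p.1 p.2) ∧
    -- comparison with the tabulated parameters (length, dimension, distance)
    (∀ t ∈ ([(589, 553, 4), (589, 513, 6), (627, 561, 5), (627, 531, 6), (627, 501, 7),
        (629, 557, 6), (629, 533, 7), (629, 521, 8)] : List (ℕ × ℕ × ℕ)),
      ∃ k : ℕ, ExistsQuantumCode 8 586 k t.2.2 ∧ t.2.1 < k ∧ 586 < t.1) := by
  -- Every parameter pair needed has this form with m equal to the distance minus 2; distance 15
  -- corresponds to m = 13.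
  have hcode : ∀ k m, m ≤ 13 → k + 4 * m = 584 →
      (∃ 𝒮 : Set (Set (ZMod 585)), IsAdmissible 64 585 8 (m + 2) 𝒮 ∧
        (∀ (F K : Type) [Field F] [Field K] [Algebra F K],
          Nat.card F = 64 → Nat.card K = 64 ^ 2 →
            k + 2 * Module.finrank F (polyCode 64 585 F K 𝒮) = 586)) ∧
      ExistsQuantumCode 8 586 k (m + 2) := by
    intro k m hm hk
    refine ⟨⟨traceCosets m, isAdmissible_traceCosets hm, fun F K _ _ _ hF hK => ?_⟩, ?_⟩
    · rw [finrank_polyCode_traceCosets hF hK hm]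
      omega
    · obtain rfl : k = 584 - 4 * m := by omega
      exact existsQuantumCode_586 hm
  refine ⟨orderOf_eq_prime (by decide) (by decide), ⟨traceCosets 2, traceCosets_two,
    scaleCosets_traceCosets_two, dualCosets_scaleCosets_traceCosets_two,
    isAdmissible_traceCosets (by norm_num), fun F K _ _ _ hF hK => ?_⟩,
    (hcode 576 2 (by norm_num) (by norm_num)).2, fun p hp => ?_, fun t ht => ?_⟩
  · rw [finrank_polyCode_traceCosets hF hK (by norm_num)]
  · have hp' : (p.2 - 2 ≤ 13 ∧ p.1 + 4 * (p.2 - 2) = 584) ∧ p.2 - 2 + 2 = p.2 := by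
      revert p
      decide
    have := hcode p.1 (p.2 - 2) hp'.1.1 hp'.1.2
    rwa [hp'.2] at this
  · have ht' : (t.2.2 - 2 ≤ 13 ∧ 584 - 4 * (t.2.2 - 2) + 4 * (t.2.2 - 2) = 584) ∧
        t.2.2 - 2 + 2 = t.2.2 ∧ t.2.1 < 584 - 4 * (t.2.2 - 2) ∧ 586 < t.1 := by
      revert t
      decide
    have := (hcode (584 - 4 * (t.2.2 - 2)) (t.2.2 - 2) ht'.1.1 ht'.1.2).2
    rw [ht'.2.1] at this
    exact ⟨_, this, ht'.2.2⟩
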